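/- Let $n,m\ge 1$ and let $\rho$ be a $2^n\times 2^n$ density matrix (positive semidefinite, $\mathrm{Tr}\,\rho=1$). Let $\sigma_x,\sigma_y,\sigma_z$ be the Pauli matrices, $\sigma_I=I$, and $\sigma_{\mathbf b}=\sigma_{b_1}\otimes\cdots\otimes\sigma_{b_n}$ for $\mathbf b\in\{I,x,y,z\}^n$. For a setting $\mathbf a\in\{x,y,z\}^n$ and an outcome $\mathbf r\in\{-1,1\}^n$ put $P^{\mathbf a}_{\mathbf r}=P^{a_1}_{r_1}\otimes\cdots\otimes P^{a_n}_{r_n}$, where $P^{t}_{s}$ is the orthogonal projector onto the eigenspace of $\sigma_t$ for the eigenvalue $s$. Let $R^{\mathbf a,i}$, $\mathbf a\in\{x,y,z\}^n$, $1\le i\le m$, be independent random vectors with $\mathbb P(R^{\mathbf a,i}=\mathbf r)=\mathrm{Tr}(\rho P^{\mathbf a}_{\mathbf r})$, and let $\hat p(\mathbf r,\mathbf a)=\frac1m\sum_{i=1}^m \mathbf 1\{R^{\mathbf a,i}=\mathbf r\}$. With $d(\mathbf b)$ the number of indices $j$ such that $b_j=I$, define the linear estimator $$\hat\rho=\sum_{\mathbf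 b}\hat\rho_{\mathbf b}\,\sigma_{\mathbf b},\qquad \hat\rho_{\mathbf b}=\frac1{3^{d(\mathbf b)}2^n}\sum_{\mathbf r,\mathbf a}\hat p(\mathbf r,\mathbf a)\prod_{j:\,b_j\ne I} r_j\,\mathbf 1\{a_j=b_j\},$$ and, for $\nu>0$, let $\hat\rho_\nu$ be a minimizer of $R\mapsto\|R-\hat\rho\|_F^2+\nu\,\mathrm{rank}(R)$ over all Hermitian $2^n\times2^n$ matrices $R$, where $\|A\|_F^2=\mathrm{Tr}(A^\dagger A)$. Let $\theta>0$, $0<\varepsilon<1$, $c(\theta)=1+2/\theta$ and $$\nu=32(1+\theta)\left(\frac43\right)^n\frac{n\log 2-\log\varepsilon}{m}.$$ Then a minimizer always exists and, with probability larger than $1-\varepsilon$, every minimizer $\hat\rho_\nu$ satisfies $$\|\hat\rho_\nu-\rho\|_F^2\le\min_{0\le k\le 2^n}\Big\{c^2(\theta)\sum_{j>k}\lambda_j^2(\rho)+2c(\theta)\,\nu\,k\Big\},$$ where $\lambda_1(\rho)\ge\lambda_2(\rho)\ge\cdots\ge\lambda_{2^n}(\rho)$ are the eigenvalues of $\rho$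 and, with $d=\mathrm{rank}(\rho)$ and $\|\cdot\|_1$ the trace norm, $$\|\hat\rho_\nu-\rho\|_F^2\le 64\,c(\theta)(1+\theta)\,d\left(\frac43\right)^n\frac{n\log2-\log\varepsilon}{m},\qquad \|\hat\rho_\nu-\rho\|_1^2\le 64\,c(\theta)(1+\theta)\,d\left(\frac83\right)^n\frac{n\log2-\log\varepsilon}{m}.$$ -/

import Mathlib

open MeasureTheory ProbabilityTheory
open scoped ComplexOrder

namespace PauliTomography

/-- The three measurement directions `x, y, z` of one qubit. -/
inductive Axis where
  | x : Axis
  | y : Axis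
  | z : Axis
  deriving DecidableEq

instance : Fintype Axis where
  elems := {Axis.x, Axis.y, Axis.z}
  complete t := by cases t <;> decide

/-- Measurement settings `{x, y, z}ⁿ`. -/
abbrev Setting (n : ℕ) := Fin n → Axis

/-- Labels `{I, x, y, z}ⁿ` of the `n`-qubit Pauli basis; `none` is the label `I`. -/
abbrev PauliLabel (n : ℕ) := Fin n → Option Axis

/-- Measurement outcomes `{-1, 1}ⁿ`. -/
abbrev Outcome (n : ℕ) := Fin n → ℤˣ

instance : MeasurableSingletonClass ℤˣ :=
  ⟨fun a => ⟨{(a : ℤ)}, trivial, by ext; simp [Units.ext_iff]⟩⟩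

/-- The index set `{0, 1}ⁿ` (of cardinality `2ⁿ`) of the computational basis of `n` qubits. -/
abbrev Idx (n : ℕ) := Fin n → Fin 2

/-- `2ⁿ × 2ⁿ` complex matrices, with rows and columns indexed by `{0, 1}ⁿ`. -/
abbrev QMat (n : ℕ) := Matrix (Idx n) (Idx n) ℂ

/-- The Pauli matrices `σ_I = I, σ_x, σ_y, σ_z`. -/
def pauli : Option Axis → Matrix (Fin 2) (Fin 2) ℂ
  | none => 1
  | some Axis.x => !![0, 1; 1, 0]
  | some Axis.y => !![0, -Complex.I; Complex.I, 0]
  | some Axis.z => !![1, 0; 0, -1]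

/-- The Kronecker product `A₁ ⊗ ⋯ ⊗ Aₙ` of `n` one-qubit matrices. -/
def tensor {n : ℕ} (A : Fin n → Matrix (Fin 2) (Fin 2) ℂ) : QMat n :=
  Matrix.of fun i j => ∏ k, A k (i k) (j k)

/-- `σ_b = σ_{b₁} ⊗ ⋯ ⊗ σ_{bₙ}`. -/
def pauliString {n : ℕ} (b : PauliLabel n) : QMat n :=
  tensor fun k => pauli (b k)

/-- The orthogonal projector `(I + s σ_t) / 2` onto the eigenspace of `σ_t` for the eigenvalue
`s = ±1`. -/
noncomputable def proj (t : Axis) (s : ℤˣ) : Matrix (Fin 2) (Fin 2) ℂ :=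
  (1 / 2 : ℂ) • (1 + ((s : ℤ) : ℂ) • pauli (some t))

theorem pauli_mul_self (t : Axis) : pauli (some t) * pauli (some t) = 1 := by
  cases t <;> ext i j <;> fin_cases i <;> fin_cases j <;> simp [pauli]

theorem proj_isHermitian (t : Axis) (s : ℤˣ) : (proj t s).IsHermitian := by
  rcases Int.units_eq_one_or s with rfl | rfl <;> cases t <;> ext i j <;> fin_cases i <;>
    fin_cases j <;> norm_num [proj, pauli]

theorem proj_mul_self (t : Axis) (s : ℤˣ) : proj t s * proj t s = proj t s := by
  have h : ((s : ℤ) : ℂ) ^ 2 = 1 := by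
    rcases Int.units_eq_one_or s with rfl | rfl <;> simp
  simp only [proj, Matrix.smul_mul, Matrix.mul_smul, add_mul, mul_add, one_mul, mul_one,
    pauli_mul_self]
  match_scalars
  · linear_combination (1 / 4 : ℂ) * h
  · ring

/-- The range of the Hermitian idempotent `proj t s` is the eigenspace of `σ_t` for `s`. -/
theorem proj_mulVec_eq_iff (t : Axis) (s : ℤˣ) (v : Fin 2 → ℂ) :
    (proj t s).mulVec v = v ↔ (pauli (some t)).mulVec v = ((s : ℤ) : ℂ) • v := by
  have h : (((s : ℤ) : ℂ)) * ((s : ℤ) : ℂ) = 1 := by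
    rcases Int.units_eq_one_or s with rfl | rfl <;> simp
  simp only [proj, Matrix.smul_mulVec, Matrix.add_mulVec, Matrix.one_mulVec]
  generalize (pauli (some t)).mulVec v = w
  constructor
  · intro hv
    funext i
    have h3 : (1 / 2 : ℂ) * (v i + ((s : ℤ) : ℂ) * w i) = v i := congrFun hv i
    show w i = ((s : ℤ) : ℂ) * v i
    linear_combination 2 * ((s : ℤ) : ℂ) * h3 - w i * h
  · rintro rfl
    rw [smul_smul, h]
    module

/-- `P_r^a = P_{r₁}^{a₁} ⊗ ⋯ ⊗ P_{rₙ}^{aₙ}`. -/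
noncomputable def outcomeProj {n : ℕ} (a : Setting n) (r : Outcome n) : QMat n :=
  tensor fun k => proj (a k) (r k)

/-- Density matrices: positive semidefinite (hence Hermitian) with unit trace. -/
def IsDensity {n : ℕ} (ρ : QMat n) : Prop :=
  ρ.PosSemidef ∧ ρ.trace = 1

/-- `m` independent repetitions of the measurement of every setting `a ∈ {x, y, z}ⁿ` on the
state `ρ`: the outcomes `R a i` are independent random vectors (jointly in `a` and `i`) and
`ℙ(R a i = r) = Tr(ρ P_r^a)`. -/
structure IsSample {n m : ℕ} {Ω : Type*} [MeasurableSpace Ω] (P : Measure Ω) (ρ : QMat n)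
    (R : Setting n → Fin m → Ω → Outcome n) : Prop where
  measurable : ∀ a i, Measurable (R a i)
  indep : iIndepFun (fun ai : Setting n × Fin m => R ai.1 ai.2) P
  law : ∀ a i r, ((P.real {ω | R a i ω = r} : ℝ) : ℂ) = (ρ * outcomeProj a r).trace

/-- The empirical frequency `p̂(r, a)` computed from the observed outcomes `x a i`. -/
noncomputable def pHat {n m : ℕ} (x : Setting n → Fin m → Outcome n) (r : Outcome n)
    (a : Setting n) : ℝ :=
  (1 / (m : ℝ)) * ∑ i, if x a i = r then 1 else 0

/-- `d(b)`, the number of positions of `b` that carry the label `I`. -/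
def numI {n : ℕ} (b : PauliLabel n) : ℕ :=
  (Finset.univ.filter fun j => b j = none).card

/-- The matrix of the linear map `(ρ_b)_b ↦ (p(r, a))_{(r, a)}`: its entries are
`∏_{j : b_j ≠ I} r_j 1(a_j = b_j)`. -/
def designMatrix (n : ℕ) : Matrix (Outcome n × Setting n) (PauliLabel n) ℝ :=
  Matrix.of fun ra b => ∏ j ∈ Finset.univ.filter (fun j => b j ≠ none),
    ((ra.1 j : ℤ) : ℝ) * (if b j = some (ra.2 j) then 1 else 0)

/-- The coefficients `ρ̂_b` of the linear (inversion) estimator in the Pauli basis. -/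
noncomputable def coefHat {n m : ℕ} (x : Setting n → Fin m → Outcome n) (b : PauliLabel n) : ℝ :=
  (1 / (3 ^ numI b * 2 ^ n : ℝ)) *
    ∑ ra : Outcome n × Setting n, pHat x ra.1 ra.2 * designMatrix n ra b

/-- The linear estimator `ρ̂ = ∑_b ρ̂_b σ_b`. -/
noncomputable def rhoHat {n m : ℕ} (x : Setting n → Fin m → Outcome n) : QMat n :=
  ∑ b : PauliLabel n, (coefHat x b : ℂ) • pauliString b

theorem designMatrix_gram (n : ℕ) :
    (designMatrix n).transpose * designMatrix n
      = Matrix.diagonal fun b => (3 ^ numI b * 2 ^ n : ℝ) := by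
  have hU : ∀ f : ℤˣ → ℝ, ∑ s, f s = f 1 + f (-1) := fun f => by
    rw [show (Finset.univ : Finset ℤˣ) = {1, -1} from rfl,
      Finset.sum_pair (by decide)]
  have hA : ∀ f : Axis → ℝ, ∑ t, f t = f Axis.x + f Axis.y + f Axis.z := fun f => by
    rw [show (Finset.univ : Finset Axis) = {Axis.x, Axis.y, Axis.z} from rfl,
      Finset.sum_insert (by decide), Finset.sum_pair (by decide)]
    ring
  let g : ℤˣ → Axis → Option Axis → ℝ := fun s t l =>
    if l ≠ none then ((s : ℤ) : ℝ) * (if l = some t then 1 else 0) else 1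
  have hg : ∀ (r : Outcome n) (a : Setting n) (b : PauliLabel n),
      designMatrix n (r, a) b = ∏ j, g (r j) (a j) (b j) := fun r a b => by
    simp only [designMatrix, Matrix.of_apply, g, Finset.prod_filter]
  have h1 : ∀ l l' : Option Axis, ∑ s, ∑ t, g s t l * g s t l'
      = if l = l' then (if l = none then 3 else 1) * 2 else 0 := by
    intro l l'
    rw [hU, hA, hA]
    rcases l with _ | l <;> rcases l' with _ | l' <;> simp only [g]
    · norm_num
    · cases l' <;> simp
    · cases l <;> simp
    · cases l <;> cases l' <;> simp <;> norm_num
  ext b b'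
  rw [Matrix.mul_apply, Fintype.sum_prod_type]
  simp only [Matrix.transpose_apply, hg, ← Finset.prod_mul_distrib]
  have h2 : ∀ r : Outcome n, ∑ a : Setting n, ∏ j, g (r j) (a j) (b j) * g (r j) (a j) (b' j)
      = ∏ j, ∑ t, g (r j) t (b j) * g (r j) t (b' j) := fun r =>
    (Fintype.prod_sum fun j t => g (r j) t (b j) * g (r j) t (b' j)).symm
  simp only [h2]
  rw [← Fintype.prod_sum fun j s => ∑ t, g s t (b j) * g s t (b' j)]
  simp only [h1]
  rw [Matrix.diagonal_apply]
  split_ifs with hb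
  · subst hb
    simp only [if_true, Finset.prod_mul_distrib, numI, Finset.prod_const, Finset.card_univ,
      Fintype.card_fin, Finset.prod_ite, one_pow, mul_one]
  · obtain ⟨j, hj⟩ := Function.ne_iff.mp hb
    exact Finset.prod_eq_zero (Finset.mem_univ j) (if_neg hj)

/-- The coefficients are those of the method of moments, `(PᵀP)⁻¹ Pᵀ p̂`. -/
theorem coefHat_eq {n m : ℕ} (x : Setting n → Fin m → Outcome n) :
    coefHat x = (((designMatrix n).transpose * designMatrix n)⁻¹
      * (designMatrix n).transpose).mulVec fun ra => pHat x ra.1 ra.2 := by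
  have h : ((designMatrix n).transpose * designMatrix n)⁻¹
      = Matrix.diagonal fun b => (3 ^ numI b * 2 ^ n : ℝ)⁻¹ := by
    rw [designMatrix_gram]
    refine Matrix.inv_eq_right_inv ?_
    rw [Matrix.diagonal_mul_diagonal, ← Matrix.diagonal_one]
    congr 1
    funext b
    exact mul_inv_cancel₀ (by positivity)
  funext b
  rw [h, ← Matrix.mulVec_mulVec, Matrix.mulVec_diagonal]
  simp only [coefHat, one_div, Matrix.mulVec, dotProduct, Matrix.transpose_apply]
  congr 1
  exact Finset.sum_congr rfl fun _ _ => mul_comm _ _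

/-- The squared Frobenius norm `‖A‖_F² = Tr(A† A)`. -/
noncomputable def frobSq {n : ℕ} (A : QMat n) : ℝ :=
  (A.conjTranspose * A).trace.re

/-- The trace norm `‖A‖₁`: the sum of the singular values of `A`, which are the square roots of
the eigenvalues of `A† A`. -/
noncomputable def traceNorm {n : ℕ} (A : QMat n) : ℝ :=
  ∑ i, √((Matrix.isHermitian_conjTranspose_mul_self A).eigenvalues i)

/-- `R` minimizes `S ↦ ‖S - ρ̂‖_F² + ν rank(S)` over all Hermitian matrices `S`. -/
def IsRankPenalized {n : ℕ} (hat : QMat n) (ν : ℝ) (R : QMat n) : Prop :=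
  R.IsHermitian ∧ ∀ S : QMat n, S.IsHermitian →
    frobSq (R - hat) + ν * (R.rank : ℝ) ≤ frobSq (S - hat) + ν * (S.rank : ℝ)

/-- The sum `∑_{j > k} λ_j²` over the eigenvalues `λ_1 ≥ λ_2 ≥ ⋯` of a Hermitian matrix, listed
in decreasing order with multiplicity (in Lean the list starts at index `0`, so that `j > k`
becomes `k ≤ j`). -/
noncomputable def tailSq {n : ℕ} {ρ : QMat n} (hρ : ρ.IsHermitian) (k : ℕ) : ℝ :=
  ∑ j : Fin (Fintype.card (Idx n)), if k ≤ (j : ℕ) then hρ.eigenvalues₀ j ^ 2 else 0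

/-- `c(θ) = 1 + 2/θ`. -/
noncomputable def cConst (θ : ℝ) : ℝ := 1 + 2 / θ

/-- `ν(θ, ε) = 32 (1 + θ) (4/3)ⁿ (n log 2 - log ε) / m`. -/
noncomputable def nuConst (n m : ℕ) (θ ε : ℝ) : ℝ :=
  32 * (1 + θ) * (4 / 3) ^ n * ((n * Real.log 2 - Real.log ε) / m)

/-- `min_k { c(θ)² ∑_{j > k} λ_j(ρ)² + 2 c(θ) ν k }`, with `k` from `0` to `2ⁿ`. -/
noncomputable def oracleBound {n : ℕ} {ρ : QMat n} (hρ : ρ.IsHermitian) (θ ν : ℝ) : ℝ :=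
  (Finset.range (2 ^ n + 1)).inf' Finset.nonempty_range_add_one fun k =>
    cConst θ ^ 2 * tailSq hρ k + 2 * cConst θ * ν * k

end PauliTomography

/-! The proof separates a deterministic inequality from a concentration bound. Put E = ρ̂ - ρ. On
the event ‖E‖ ≤ t in operator norm, with ν = (1+θ)t², comparing a minimizer T with a Hermitian
competitor Q leaves the cross term 2 Tr((T-Q)E). Duality and Cauchy-Schwarz bound it by 2t √(rank T
+ rank Q) (‖T-ρ‖_F + ‖Q-ρ‖_F), and Young's inequality absorbs it into the penalty
(`IsRankPenalized.frobSq_sub_le`). Taking for Q the spectral truncations of ρ gives the oracle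
bound, and Q = ρ gives the rank bounds.

For the concentration, ρ̂ is an average of independent snapshots ⊗ⱼ(I/6 + rⱼσ_{aⱼ}/2), one per
measurement (`rhoHat_eq_sum_snapshot`). Their expectations sum to ρ (`sum_trace_smul_snapshot`), and
each has norm at most (2/3)ⁿ. A matrix Hoeffding inequality (`sum_prod_not_posSemidef_le`) then
bounds both tails of E. It is the Ahlswede-Winter argument: Golden-Thompson peels the independent
summands off Tr exp one at a time. Golden-Thompson (`re_trace_exp_add_le`) in turn follows from the
Lie product formula and a trace inequality for powers with exponent 2^k.

Operator-norm bounds appear throughout as pairs of semidefinite conditions t·1 ∓ E ≥ 0. -/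

namespace PauliTomography

open Filter Topology Matrix

/-! ### The Lie product formula in a real Banach algebra. -/

section LieTrotter

variable {𝔸 : Type*} [NormedRing 𝔸] [NormOneClass 𝔸]

theorem norm_pow_succ_sub_pow_succ_le {x y : 𝔸} {M : ℝ} (hx : ‖x‖ ≤ M) (hy : ‖y‖ ≤ M) (k : ℕ) :
    ‖x ^ (k + 1) - y ^ (k + 1)‖ ≤ (k + 1) * M ^ k * ‖x - y‖ := by
  have hM : 0 ≤ M := (norm_nonneg _).trans hx
  induction k with
  | zero => simp
  | succ k ih =>
    have h : x ^ (k + 1 + 1) - y ^ (k + 1 + 1)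
        = x ^ (k + 1) * (x - y) + (x ^ (k + 1) - y ^ (k + 1)) * y := by
      rw [pow_succ x (k + 1), pow_succ y (k + 1)]; noncomm_ring
    have h1 : ‖x ^ (k + 1)‖ ≤ M ^ (k + 1) :=
      (norm_pow_le _ _).trans (pow_le_pow_left₀ (norm_nonneg _) hx _)
    rw [h]
    calc _ ≤ ‖x ^ (k + 1)‖ * ‖x - y‖ + ‖x ^ (k + 1) - y ^ (k + 1)‖ * ‖y‖ :=
          (norm_add_le _ _).trans (add_le_add (norm_mul_le _ _) (norm_mul_le _ _))
      _ ≤ M ^ (k + 1) * ‖x - y‖ + ((k + 1) * M ^ k * ‖x - y‖) * M := by gcongr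
      _ = _ := by push_cast; ring

variable [NormedAlgebra ℝ 𝔸]

theorem norm_exp_le [CompleteSpace 𝔸] (x : 𝔸) : ‖NormedSpace.exp x‖ ≤ Real.exp ‖x‖ := by
  have h := NormedSpace.exp_series_hasSum_exp' (𝕂 := ℝ) x
  have h' := NormedSpace.exp_series_hasSum_exp' (𝕂 := ℝ) ‖x‖
  rw [← h.tsum_eq, Real.exp_eq_exp_ℝ]
  refine tsum_of_norm_bounded h' fun n => ?_
  rw [norm_smul, Real.norm_of_nonneg (by positivity), smul_eq_mul]
  gcongr
  exact norm_pow_le _ _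

/-- The Lie product formula. -/
theorem tendsto_exp_mul_exp_pow [CompleteSpace 𝔸] (a b : 𝔸) :
    Tendsto (fun k : ℕ => (NormedSpace.exp ((k + 1 : ℝ)⁻¹ • a)
      * NormedSpace.exp ((k + 1 : ℝ)⁻¹ • b)) ^ (k + 1)) atTop (𝓝 (NormedSpace.exp (a + b))) := by
  -- Both curves have derivative a + b at 0, so they differ by o(1/k) at time 1/(k+1). Taking
  -- (k+1)-st powers magnifies the difference by at most (k+1)·exp(‖a‖+‖b‖).
  have hd : HasDerivAt (fun t : ℝ => NormedSpace.exp (t • a) * NormedSpace.exp (t • b)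
      - NormedSpace.exp (t • (a + b))) 0 0 := by
    have h := ((hasDerivAt_exp_smul_const a (0 : ℝ)).mul
      (hasDerivAt_exp_smul_const b (0 : ℝ))).sub (hasDerivAt_exp_smul_const (a + b) (0 : ℝ))
    simpa using! h
  have hu : Tendsto (fun k : ℕ => (k + 1 : ℝ)⁻¹) atTop (𝓝[≠] 0) := by
    refine tendsto_nhdsWithin_iff.2 ⟨?_, .of_forall fun k => ?_⟩
    · simpa using tendsto_one_div_add_atTop_nhds_zero_nat (𝕜 := ℝ)
    · simp only [Set.mem_compl_iff, Set.mem_singleton_iff]; positivity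
  have hs := (hasDerivAt_iff_tendsto_slope.1 hd).comp hu
  rw [tendsto_iff_norm_sub_tendsto_zero]
  have hs' := (hs.norm).const_mul (Real.exp (‖a‖ + ‖b‖))
  simp only [norm_zero, mul_zero] at hs'
  refine squeeze_zero (fun _ => norm_nonneg _) (fun k => ?_) hs'
  have hk : (0 : ℝ) < k + 1 := by positivity
  have e : NormedSpace.exp (a + b) = (NormedSpace.exp ((k + 1 : ℝ)⁻¹ • (a + b))) ^ (k + 1) := by
    let := NormedAlgebra.restrictScalars ℚ ℝ 𝔸
    rw [← NormedSpace.exp_nsmul, ← Nat.cast_smul_eq_nsmul ℝ, smul_smul]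
    push_cast
    rw [mul_inv_cancel₀ hk.ne', one_smul]
  have hn : ∀ c : 𝔸, ‖(k + 1 : ℝ)⁻¹ • c‖ = (k + 1 : ℝ)⁻¹ * ‖c‖ := fun c => by
    rw [norm_smul, Real.norm_of_nonneg (by positivity)]
  have hM1 : ‖NormedSpace.exp ((k + 1 : ℝ)⁻¹ • a) * NormedSpace.exp ((k + 1 : ℝ)⁻¹ • b)‖
      ≤ Real.exp ((k + 1 : ℝ)⁻¹ * (‖a‖ + ‖b‖)) := by
    refine (norm_mul_le _ _).trans ?_
    rw [mul_add, Real.exp_add, ← hn, ← hn]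
    gcongr <;> exact norm_exp_le _
  have hM2 : ‖NormedSpace.exp ((k + 1 : ℝ)⁻¹ • (a + b))‖
      ≤ Real.exp ((k + 1 : ℝ)⁻¹ * (‖a‖ + ‖b‖)) := by
    refine (norm_exp_le _).trans ?_
    rw [hn]
    gcongr
    exact norm_add_le _ _
  rw [e]
  refine (norm_pow_succ_sub_pow_succ_le hM1 hM2 k).trans ?_
  simp only [Function.comp, slope_def_module, sub_zero, zero_smul, NormedSpace.exp_zero, mul_one,
    sub_self]
  rw [norm_smul, inv_inv, Real.norm_of_nonneg hk.le, ← mul_assoc]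
  refine mul_le_mul_of_nonneg_right ?_ (norm_nonneg _)
  rw [mul_comm]
  gcongr
  rw [← Real.exp_nat_mul]
  gcongr
  rw [← mul_assoc]
  refine mul_le_of_le_one_left (by positivity) ?_
  rw [← div_eq_mul_inv, div_le_one hk]
  linarith

end LieTrotter

/-! ### Trace inequalities for powers, and Golden-Thompson. -/

section TraceInequalities

variable {κ : Type*} [Fintype κ]

theorem norm_trace_mul_sq_le (P Q : Matrix κ κ ℂ) :
    ‖(P * Q).trace‖ ^ 2 ≤ (P * Pᴴ).trace.re * (Q * Qᴴ).trace.re := by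
  have h1 : ∀ A : Matrix κ κ ℂ, (A * Aᴴ).trace.re = ∑ x : κ × κ, ‖A x.1 x.2‖ ^ 2 := fun A => by
    simp only [Matrix.trace, Matrix.diag, Matrix.mul_apply, Matrix.conjTranspose_apply,
      Complex.re_sum, Fintype.sum_prod_type, Complex.star_def, Complex.mul_conj,
      Complex.normSq_eq_norm_sq, Complex.ofReal_re]
  have h2 : (Q * Qᴴ).trace.re = ∑ x : κ × κ, ‖Q x.2 x.1‖ ^ 2 := by
    rw [h1, ← (Equiv.prodComm κ κ).sum_comp]; rfl
  have h3 : ‖(P * Q).trace‖ ≤ ∑ x : κ × κ, ‖P x.1 x.2‖ * ‖Q x.2 x.1‖ := by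
    simp only [Matrix.trace, Matrix.diag, Matrix.mul_apply, Fintype.sum_prod_type]
    refine (norm_sum_le _ _).trans (Finset.sum_le_sum fun i _ => (norm_sum_le _ _).trans ?_)
    simp
  rw [h1, h2]
  exact (pow_le_pow_left₀ (norm_nonneg _) h3 2).trans (Finset.sum_mul_sq_le_sq_mul_sq _ _ _)

variable [DecidableEq κ]

theorem trace_mul_pow_comm (P Q : Matrix κ κ ℂ) (k : ℕ) :
    ((P * Q) ^ k).trace = ((Q * P) ^ k).trace := by
  cases k with
  | zero => simp
  | succ k =>
    have h : (P * Q) ^ (k + 1) = P * (Q * P) ^ k * Q := by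
      rw [pow_succ, ← mul_assoc]
      congr 1
      induction k with
      | zero => simp
      | succ k ih => rw [pow_succ, pow_succ, ← mul_assoc, ih]; simp only [mul_assoc]
    rw [h, Matrix.trace_mul_comm, ← mul_assoc, ← pow_succ']

theorem re_trace_pow_nonneg (P : Matrix κ κ ℂ) (k : ℕ) : 0 ≤ ((P * Pᴴ) ^ k).trace.re :=
  (Complex.le_def.1 ((posSemidef_self_mul_conjTranspose P).pow k).trace_nonneg).1

/-- Cauchy-Schwarz is the case k = 0. Each doubling uses the induction hypothesis twice: for (PQ,
PQ), and then, after a cyclic rotation under the trace, for (QQᴴ, PᴴP). Hence the induction must run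
over all pairs. -/
theorem norm_trace_mul_pow_two_pow_sq_le (k : ℕ) (P Q : Matrix κ κ ℂ) :
    ‖((P * Q) ^ 2 ^ k).trace‖ ^ 2
      ≤ ((P * Pᴴ) ^ 2 ^ k).trace.re * ((Q * Qᴴ) ^ 2 ^ k).trace.re := by
  induction k generalizing P Q with
  | zero => simpa using norm_trace_mul_sq_le P Q
  | succ k ih =>
    have h1 := ih (P * Q) (P * Q)
    have h2 := ih (Q * Qᴴ) (Pᴴ * P)
    have e1 : ((P * Q * (P * Q)ᴴ) ^ 2 ^ k).trace = ((Q * Qᴴ * (Pᴴ * P)) ^ 2 ^ k).trace := by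
      rw [Matrix.conjTranspose_mul, mul_assoc, trace_mul_pow_comm]
      simp only [mul_assoc]
    have e2 : ((Pᴴ * P * (Pᴴ * P)ᴴ) ^ 2 ^ k).trace = ((P * Pᴴ) ^ 2 ^ (k + 1)).trace := by
      rw [trace_mul_pow_comm P, pow_succ 2 k, mul_comm (2 ^ k) 2, pow_mul, sq]
      simp
    have e3 : (Q * Qᴴ * (Q * Qᴴ)ᴴ) ^ 2 ^ k = (Q * Qᴴ) ^ 2 ^ (k + 1) := by
      rw [pow_succ 2 k, mul_comm (2 ^ k) 2, pow_mul, sq]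
      simp
    have e4 : (P * Q * (P * Q)) ^ 2 ^ k = (P * Q) ^ 2 ^ (k + 1) := by
      rw [pow_succ 2 k, mul_comm (2 ^ k) 2, pow_mul, sq]
    rw [e2, e3] at h2
    rw [e4, e1] at h1
    have h3 := Complex.re_le_norm ((Q * Qᴴ * (Pᴴ * P)) ^ 2 ^ k).trace
    have h4 : 0 ≤ ((Q * Qᴴ * (Pᴴ * P)) ^ 2 ^ k).trace.re := by
      rw [← e1]; exact re_trace_pow_nonneg _ _
    nlinarith

/-- The previous lemma bounds Tr (XY)^(2^(k+1)) by Tr (XY(XY)ᴴ)^(2^k), which is Tr (X²Y²)^(2^k) by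
cyclicity. The induction hypothesis then applies to X² and Y². -/
theorem re_trace_mul_pow_two_pow_le (k : ℕ) {X Y : Matrix κ κ ℂ} (hX : X.IsHermitian)
    (hY : Y.IsHermitian) :
    ((X * Y) ^ 2 ^ k).trace.re ≤ (X ^ 2 ^ k * Y ^ 2 ^ k).trace.re := by
  induction k generalizing X Y with
  | zero => simp
  | succ k ih =>
    have h1 := norm_trace_mul_pow_two_pow_sq_le k (X * Y) (X * Y)
    have e4 : (X * Y * (X * Y)) ^ 2 ^ k = (X * Y) ^ 2 ^ (k + 1) := by
      rw [pow_succ 2 k, mul_comm (2 ^ k) 2, pow_mul, sq]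
    have e1 : ((X * Y * (X * Y)ᴴ) ^ 2 ^ k).trace = ((X ^ 2 * Y ^ 2) ^ 2 ^ k).trace := by
      rw [Matrix.conjTranspose_mul, hX.eq, hY.eq, ← mul_assoc, trace_mul_pow_comm]
      simp only [mul_assoc, sq]
    have h0 := re_trace_pow_nonneg (X * Y) (2 ^ k)
    rw [e4] at h1
    have h2 := abs_le_of_sq_le_sq (by nlinarith : ‖((X * Y) ^ 2 ^ (k + 1)).trace‖ ^ 2 ≤
      ((X * Y * (X * Y)ᴴ) ^ 2 ^ k).trace.re ^ 2) h0
    have h3 := Complex.re_le_norm ((X * Y) ^ 2 ^ (k + 1)).trace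
    have h4 := ih (hX.pow 2) (hY.pow 2)
    rw [← pow_mul, ← pow_mul, ← pow_succ', ← e1] at h4
    exact h3.trans ((le_abs_self _).trans (h2.trans h4))

open scoped Matrix.Norms.Operator in
/-- The Golden-Thompson inequality. -/
theorem re_trace_exp_add_le [Nonempty κ] {A B : Matrix κ κ ℂ} (hA : A.IsHermitian)
    (hB : B.IsHermitian) :
    (NormedSpace.exp (A + B)).trace.re ≤ (NormedSpace.exp A * NormedSpace.exp B).trace.re := by
  -- The Lie formula is sampled at k + 1 = 2^j, the only exponents covered by the trace inequality.
  have h2 : Tendsto (fun j : ℕ => 2 ^ j - 1) atTop atTop :=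
    (tendsto_sub_atTop_nat 1).comp (tendsto_pow_atTop_atTop_of_one_lt one_lt_two)
  have h := (tendsto_exp_mul_exp_pow A B).comp h2
  have ht : Continuous fun M : Matrix κ κ ℂ => M.trace.re :=
    Complex.continuous_re.comp (continuous_id.matrix_trace)
  refine le_of_tendsto ((ht.tendsto _).comp h) (.of_forall fun j => ?_)
  have hj : 2 ^ j - 1 + 1 = 2 ^ j := Nat.sub_add_cancel Nat.one_le_two_pow
  have hc : ((2 ^ j - 1 : ℕ) : ℝ) + 1 = ((2 ^ j : ℕ) : ℝ) := by exact_mod_cast hj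
  simp only [Function.comp, hj, hc]
  have hs : ∀ {C : Matrix κ κ ℂ}, C.IsHermitian →
      ((((2 ^ j : ℕ) : ℝ)⁻¹) • C).IsHermitian := fun {C} hC => by
    simp [Matrix.IsHermitian, Matrix.conjTranspose_smul, hC.eq]
  have he : ∀ C : Matrix κ κ ℂ,
      NormedSpace.exp ((((2 ^ j : ℕ) : ℝ)⁻¹) • C) ^ 2 ^ j = NormedSpace.exp C := fun C => by
    rw [← Matrix.exp_nsmul, ← Nat.cast_smul_eq_nsmul ℝ, smul_smul, mul_inv_cancel₀ (by positivity),
      one_smul]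
  refine (re_trace_mul_pow_two_pow_le j (hs hA).exp (hs hB).exp).trans_eq ?_
  rw [he, he]

end TraceInequalities

/-! ### Functional calculus of a Hermitian matrix through its eigenbasis. -/

section SpectralFunctions

variable {κ : Type*} [Fintype κ] [DecidableEq κ] {A : Matrix κ κ ℂ}

/-- The Hermitian matrix with the eigenvectors of `A` and the prescribed eigenvalues `f`. -/
noncomputable def spectralMatrix (hA : A.IsHermitian) (f : κ → ℝ) : Matrix κ κ ℂ :=
  (hA.eigenvectorUnitary : Matrix κ κ ℂ) * diagonal (fun i => (f i : ℂ))
    * (hA.eigenvectorUnitary : Matrix κ κ ℂ)ᴴ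

variable (hA : A.IsHermitian)

theorem eigenvectorUnitary_mul_conjTranspose :
    (hA.eigenvectorUnitary : Matrix κ κ ℂ) * (hA.eigenvectorUnitary : Matrix κ κ ℂ)ᴴ = 1 :=
  Unitary.coe_mul_star_self _

theorem conjTranspose_mul_eigenvectorUnitary :
    (hA.eigenvectorUnitary : Matrix κ κ ℂ)ᴴ * (hA.eigenvectorUnitary : Matrix κ κ ℂ) = 1 :=
  Unitary.coe_star_mul_self _

theorem spectralMatrix_eigenvalues : spectralMatrix hA hA.eigenvalues = A := by
  conv_rhs => rw [hA.spectral_theorem, Unitary.conjStarAlgAut_apply]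
  rfl

theorem spectralMatrix_sub (f g : κ → ℝ) :
    spectralMatrix hA (f - g) = spectralMatrix hA f - spectralMatrix hA g := by
  simp only [spectralMatrix, ← sub_mul, ← mul_sub, diagonal_sub, Pi.sub_apply, Complex.ofReal_sub]

theorem spectralMatrix_add (f g : κ → ℝ) :
    spectralMatrix hA (f + g) = spectralMatrix hA f + spectralMatrix hA g := by
  simp only [spectralMatrix, ← add_mul, ← mul_add, diagonal_add, Pi.add_apply, Complex.ofReal_add]

theorem spectralMatrix_smul (c : ℝ) (f : κ → ℝ) :
    spectralMatrix hA (c • f) = (c : ℂ) • spectralMatrix hA f := by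
  have : diagonal (fun i => ((c • f) i : ℂ)) = (c : ℂ) • diagonal (fun i => (f i : ℂ)) := by
    ext i j; by_cases h : i = j <;> simp [diagonal, h]
  simp only [spectralMatrix, this, Matrix.mul_smul, Matrix.smul_mul]

theorem spectralMatrix_one : spectralMatrix hA 1 = 1 := by
  simp [spectralMatrix, eigenvectorUnitary_mul_conjTranspose]

theorem spectralMatrix_mul (f g : κ → ℝ) :
    spectralMatrix hA f * spectralMatrix hA g = spectralMatrix hA (f * g) := by
  have h : ∀ U D E V : Matrix κ κ ℂ, V * U = 1 → U * D * V * (U * E * V) = U * (D * E) * V :=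
    fun U D E V h => by
      rw [show U * D * V * (U * E * V) = U * D * (V * U) * E * V by simp only [mul_assoc], h]
      simp only [mul_assoc, mul_one]
  rw [spectralMatrix, spectralMatrix, h _ _ _ _ (conjTranspose_mul_eigenvectorUnitary hA)]
  simp [spectralMatrix]

theorem spectralMatrix_isHermitian (f : κ → ℝ) : (spectralMatrix hA f).IsHermitian := by
  simp only [Matrix.IsHermitian, spectralMatrix, conjTranspose_mul, conjTranspose_conjTranspose,
    diagonal_conjTranspose, mul_assoc]
  congr 3
  ext i
  simp

theorem trace_spectralMatrix (f : κ → ℝ) : (spectralMatrix hA f).trace = ∑ i, (f i : ℂ) := by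
  rw [spectralMatrix, trace_mul_comm, ← mul_assoc, conjTranspose_mul_eigenvectorUnitary, one_mul,
    trace_diagonal]

theorem rank_spectralMatrix_le (f : κ → ℝ) :
    (spectralMatrix hA f).rank ≤ (Finset.univ.filter fun i => f i ≠ 0).card := by
  refine (rank_mul_le_left _ _).trans ((rank_mul_le_right _ _).trans_eq ?_)
  rw [rank_diagonal, Fintype.card_subtype]
  simp

theorem exp_eq_spectralMatrix :
    NormedSpace.exp A = spectralMatrix hA fun i => Real.exp (hA.eigenvalues i) := by
  have hinv : (hA.eigenvectorUnitary : Matrix κ κ ℂ)⁻¹ = (hA.eigenvectorUnitary : Matrix κ κ ℂ)ᴴ :=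
    inv_eq_right_inv (eigenvectorUnitary_mul_conjTranspose hA)
  conv_lhs => rw [← spectralMatrix_eigenvalues hA]
  rw [spectralMatrix, ← hinv, exp_conj _ _ (IsUnit.of_mul_eq_one _
    (eigenvectorUnitary_mul_conjTranspose hA)), exp_diagonal, spectralMatrix, hinv]
  congr 3
  ext i
  rw [Pi.exp_def, ← Complex.exp_eq_exp_ℂ, Complex.ofReal_exp]

theorem posSemidef_spectralMatrix_iff (f : κ → ℝ) :
    (spectralMatrix hA f).PosSemidef ↔ ∀ i, 0 ≤ f i := by
  have hU : IsUnit (hA.eigenvectorUnitary : Matrix κ κ ℂ) :=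
    IsUnit.of_mul_eq_one _ (eigenvectorUnitary_mul_conjTranspose hA)
  rw [spectralMatrix, ← star_eq_conjTranspose, hU.posSemidef_star_right_conjugate_iff,
    posSemidef_diagonal_iff]
  simp

theorem smul_one_sub_eq_spectralMatrix (c : ℝ) :
    (c : ℂ) • 1 - A = spectralMatrix hA (c • 1 - hA.eigenvalues) := by
  rw [spectralMatrix_sub, spectralMatrix_smul, spectralMatrix_one, spectralMatrix_eigenvalues]

theorem smul_one_add_eq_spectralMatrix (c : ℝ) :
    (c : ℂ) • 1 + A = spectralMatrix hA (c • 1 + hA.eigenvalues) := by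
  rw [spectralMatrix_add, spectralMatrix_smul, spectralMatrix_one, spectralMatrix_eigenvalues]

theorem posSemidef_smul_one_sub_iff (c : ℝ) :
    ((c : ℂ) • 1 - A).PosSemidef ↔ ∀ i, hA.eigenvalues i ≤ c := by
  rw [smul_one_sub_eq_spectralMatrix hA, posSemidef_spectralMatrix_iff]
  simp

theorem posSemidef_smul_one_add_iff (c : ℝ) :
    ((c : ℂ) • 1 + A).PosSemidef ↔ ∀ i, -c ≤ hA.eigenvalues i := by
  rw [smul_one_add_eq_spectralMatrix hA, posSemidef_spectralMatrix_iff]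
  simp [neg_le_iff_add_nonneg']

end SpectralFunctions

/-! ### A matrix Hoeffding inequality for finitely supported laws. -/

section MatrixHoeffding

variable {κ : Type*} [DecidableEq κ] {β : Type*} [Fintype β]

/-- A finitely supported random Hermitian matrix, given by the probabilities `p` and the values
`X`, that is centred and bounded by `c`. -/
structure IsCentredBounded (p : β → ℝ) (X : β → Matrix κ κ ℂ) (c : ℝ) : Prop where
  nonneg : ∀ r, 0 ≤ p r
  sum_eq_one : ∑ r, p r = 1
  isHermitian : ∀ r, (X r).IsHermitian
  mean_eq_zero : ∑ r, (p r : ℂ) • X r = 0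
  le_bound : ∀ r, ((c : ℂ) • 1 - X r).PosSemidef
  neg_bound_le : ∀ r, ((c : ℂ) • 1 + X r).PosSemidef

theorem IsCentredBounded.neg {p : β → ℝ} {X : β → Matrix κ κ ℂ} {c : ℝ}
    (h : IsCentredBounded p X c) : IsCentredBounded p (fun r => -X r) c where
  nonneg := h.nonneg
  sum_eq_one := h.sum_eq_one
  isHermitian r := (h.isHermitian r).neg
  mean_eq_zero := by simpa using h.mean_eq_zero
  le_bound r := by simpa using h.neg_bound_le r
  neg_bound_le r := by simpa [sub_eq_add_neg] using h.le_bound r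

theorem IsCentredBounded.smul {p : β → ℝ} {X : β → Matrix κ κ ℂ} {c : ℝ}
    (h : IsCentredBounded p X c) {s : ℝ} (hs : 0 ≤ s) :
    IsCentredBounded p (fun r => (s : ℂ) • X r) (s * c) where
  nonneg := h.nonneg
  sum_eq_one := h.sum_eq_one
  isHermitian r := by simp [Matrix.IsHermitian, conjTranspose_smul, (h.isHermitian r).eq]
  mean_eq_zero := by
    have : ∑ r, (p r : ℂ) • (s : ℂ) • X r = (s : ℂ) • ∑ r, (p r : ℂ) • X r := by
      rw [Finset.smul_sum]
      exact Finset.sum_congr rfl fun r _ => smul_comm _ _ _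
    rw [this, h.mean_eq_zero, smul_zero]
  le_bound r := by
    have := (h.le_bound r).smul (Complex.zero_le_real.2 hs)
    rwa [smul_sub, smul_smul, ← Complex.ofReal_mul] at this
  neg_bound_le r := by
    have := (h.neg_bound_le r).smul (Complex.zero_le_real.2 hs)
    rwa [smul_add, smul_smul, ← Complex.ofReal_mul] at this

variable [Fintype κ]

/-- With C the square root of A, Tr(AB) = Tr(CBC) and CBC is positive semidefinite. -/
theorem re_trace_mul_nonneg {A B : Matrix κ κ ℂ} (hA : A.PosSemidef) (hB : B.PosSemidef) :
    0 ≤ (A * B).trace.re := by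
  have h : A = spectralMatrix hA.1 (fun i => √(hA.1.eigenvalues i))
      * spectralMatrix hA.1 (fun i => √(hA.1.eigenvalues i)) := by
    rw [spectralMatrix_mul]
    conv_lhs => rw [← spectralMatrix_eigenvalues hA.1]
    congr 1
    ext i
    exact (Real.mul_self_sqrt (hA.eigenvalues_nonneg i)).symm
  have hC := spectralMatrix_isHermitian hA.1 (fun i => √(hA.1.eigenvalues i))
  rw [h, mul_assoc, trace_mul_comm]
  have := hB.mul_mul_conjTranspose_same (spectralMatrix hA.1 (fun i => √(hA.1.eigenvalues i)))
  rw [hC.eq] at this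
  exact (Complex.le_def.1 this.trace_nonneg).1

theorem posSemidef_exp {A : Matrix κ κ ℂ} (hA : A.IsHermitian) :
    (NormedSpace.exp A).PosSemidef := by
  rw [exp_eq_spectralMatrix hA, posSemidef_spectralMatrix_iff]
  exact fun i => (Real.exp_pos _).le

/-- The matrix form of the chord bound for `exp` on `[-c, c]`. -/
theorem posSemidef_cosh_add_sinh_sub_exp {X : Matrix κ κ ℂ} (hX : X.IsHermitian) {c : ℝ}
    (hc : 0 < c) (h1 : ((c : ℂ) • 1 - X).PosSemidef) (h2 : ((c : ℂ) • 1 + X).PosSemidef) :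
    ((Real.cosh c : ℂ) • 1 + ((Real.sinh c / c : ℝ) : ℂ) • X - NormedSpace.exp X).PosSemidef := by
  rw [posSemidef_smul_one_sub_iff hX] at h1
  rw [posSemidef_smul_one_add_iff hX] at h2
  have h : (Real.cosh c : ℂ) • 1 + ((Real.sinh c / c : ℝ) : ℂ) • X - NormedSpace.exp X
      = spectralMatrix hX ((Real.cosh c • 1 + (Real.sinh c / c) • hX.eigenvalues)
        - fun i => Real.exp (hX.eigenvalues i)) := by
    rw [spectralMatrix_sub, spectralMatrix_add, spectralMatrix_smul, spectralMatrix_smul,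
      spectralMatrix_one, spectralMatrix_eigenvalues, exp_eq_spectralMatrix hX]
  rw [h, posSemidef_spectralMatrix_iff]
  intro i
  have := Real.exp_mul_le_cosh_add_mul_sinh (t := hX.eigenvalues i / c)
    (by rw [abs_div, abs_of_pos hc, div_le_one hc]; exact abs_le.2 ⟨h2 i, h1 i⟩) c
  rw [div_mul_cancel₀ _ hc.ne'] at this
  simp only [Pi.sub_apply, Pi.add_apply, Pi.smul_apply, Pi.one_apply, smul_eq_mul, mul_one,
    sub_nonneg]
  calc _ ≤ _ := this
    _ = _ := by ring

/-- Averaging the chord bound kills its linear term because X is centred; then cosh c ≤ exp(c²/2).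
-/
theorem IsCentredBounded.posSemidef_exp_sub {p : β → ℝ} {X : β → Matrix κ κ ℂ} {c : ℝ}
    (h : IsCentredBounded p X c) (hc : 0 < c) :
    ((Real.exp (c ^ 2 / 2) : ℂ) • 1 - ∑ r, (p r : ℂ) • NormedSpace.exp (X r)).PosSemidef := by
  have h1 : (∑ r, (p r : ℂ) • ((Real.cosh c : ℂ) • 1 + ((Real.sinh c / c : ℝ) : ℂ) • X r
      - NormedSpace.exp (X r))).PosSemidef :=
    posSemidef_sum _ fun r _ => (posSemidef_cosh_add_sinh_sub_exp (h.isHermitian r) hc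
      (h.le_bound r) (h.neg_bound_le r)).smul (Complex.zero_le_real.2 (h.nonneg r))
  have h2 : (((Real.exp (c ^ 2 / 2) - Real.cosh c : ℝ) : ℂ) • (1 : Matrix κ κ ℂ)).PosSemidef :=
    PosSemidef.one.smul (Complex.zero_le_real.2 (sub_nonneg.2 (Real.cosh_le_exp_half_sq c)))
  have h3 : ∑ r, (p r : ℂ) • ((Real.cosh c : ℂ) • 1 + ((Real.sinh c / c : ℝ) : ℂ) • X r
      - NormedSpace.exp (X r)) = (Real.cosh c : ℂ) • 1 - ∑ r, (p r : ℂ) • NormedSpace.exp (X r) := by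
    have hp : ∑ r, (p r : ℂ) = 1 := by exact_mod_cast h.sum_eq_one
    have hm : ∑ r, (p r : ℂ) • ((Real.sinh c / c : ℝ) : ℂ) • X r
        = ((Real.sinh c / c : ℝ) : ℂ) • ∑ r, (p r : ℂ) • X r := by
      rw [Finset.smul_sum]
      exact Finset.sum_congr rfl fun r _ => smul_comm _ _ _
    simp only [smul_sub, smul_add, Finset.sum_sub_distrib, Finset.sum_add_distrib]
    rw [hm, h.mean_eq_zero, smul_zero, add_zero, ← Finset.sum_smul, hp, one_smul]
  rw [h3] at h1
  convert h1.add h2 using 1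
  rw [Complex.ofReal_sub, sub_smul]
  abel

/-- Golden-Thompson splits exp(H + X), after which the average of exp X is a single matrix. Its
semidefinite bound survives the trace against exp H ≥ 0. -/
theorem IsCentredBounded.sum_re_trace_exp_le [Nonempty κ] {p : β → ℝ} {X : β → Matrix κ κ ℂ}
    {c : ℝ} (h : IsCentredBounded p X c) (hc : 0 < c) {H : Matrix κ κ ℂ} (hH : H.IsHermitian) :
    ∑ r, p r * (NormedSpace.exp (H + X r)).trace.re
      ≤ Real.exp (c ^ 2 / 2) * (NormedSpace.exp H).trace.re := by
  have h1 : ∑ r, p r * (NormedSpace.exp (H + X r)).trace.re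
      ≤ ∑ r, p r * (NormedSpace.exp H * NormedSpace.exp (X r)).trace.re :=
    Finset.sum_le_sum fun r _ => mul_le_mul_of_nonneg_left
      (re_trace_exp_add_le hH (h.isHermitian r)) (h.nonneg r)
  have h2 := re_trace_mul_nonneg (posSemidef_exp hH) (h.posSemidef_exp_sub hc)
  rw [mul_sub, trace_sub, Finset.mul_sum, trace_sum, Complex.sub_re, Complex.re_sum, sub_nonneg]
    at h2
  simp only [Matrix.mul_smul, trace_smul, smul_eq_mul, mul_one, Complex.re_ofReal_mul] at h2
  exact h1.trans h2

/-- The free matrix H makes the induction work: it absorbs the first summand while the other N are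
averaged out. -/
theorem sum_prod_re_trace_exp_le_fin [Nonempty κ] {c : ℝ} (hc : 0 < c) (N : ℕ)
    {p : Fin N → β → ℝ} {X : Fin N → β → Matrix κ κ ℂ}
    (h : ∀ k, IsCentredBounded (p k) (X k) c) {H : Matrix κ κ ℂ} (hH : H.IsHermitian) :
    ∑ x : Fin N → β, (∏ k, p k (x k)) * (NormedSpace.exp (H + ∑ k, X k (x k))).trace.re
      ≤ Real.exp (c ^ 2 / 2) ^ N * (NormedSpace.exp H).trace.re := by
  induction N generalizing H with
  | zero => simp
  | succ N ih =>
    rw [← (Fin.consEquiv fun _ => β).sum_comp, Fintype.sum_prod_type]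
    have h1 : ∀ r : β, ∑ x : Fin N → β, (∏ k, p k.succ (x k))
        * (NormedSpace.exp (H + X 0 r + ∑ k, X k.succ (x k))).trace.re
          ≤ Real.exp (c ^ 2 / 2) ^ N * (NormedSpace.exp (H + X 0 r)).trace.re := fun r =>
      ih (fun k => h k.succ) (hH.add ((h 0).isHermitian r))
    calc _ = ∑ r, p 0 r * ∑ x : Fin N → β, (∏ k, p k.succ (x k))
        * (NormedSpace.exp (H + X 0 r + ∑ k, X k.succ (x k))).trace.re := by
          refine Finset.sum_congr rfl fun r _ => ?_
          rw [Finset.mul_sum]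
          refine Finset.sum_congr rfl fun x _ => ?_
          simp [Fin.consEquiv, Fin.prod_univ_succ, Fin.sum_univ_succ, mul_assoc, add_assoc]
      _ ≤ ∑ r, p 0 r * (Real.exp (c ^ 2 / 2) ^ N * (NormedSpace.exp (H + X 0 r)).trace.re) :=
          Finset.sum_le_sum fun r _ => mul_le_mul_of_nonneg_left (h1 r) ((h 0).nonneg r)
      _ = Real.exp (c ^ 2 / 2) ^ N * ∑ r, p 0 r * (NormedSpace.exp (H + X 0 r)).trace.re := by
          rw [Finset.mul_sum]
          exact Finset.sum_congr rfl fun r _ => by ring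
      _ ≤ Real.exp (c ^ 2 / 2) ^ N * (Real.exp (c ^ 2 / 2) * (NormedSpace.exp H).trace.re) := by
          gcongr
          exact (h 0).sum_re_trace_exp_le hc hH
      _ = _ := by ring

variable {ι : Type*} [Fintype ι] [DecidableEq ι]

theorem sum_prod_re_trace_exp_le [Nonempty κ] {c : ℝ} (hc : 0 < c)
    {p : ι → β → ℝ} {X : ι → β → Matrix κ κ ℂ} (h : ∀ k, IsCentredBounded (p k) (X k) c) :
    ∑ x : ι → β, (∏ k, p k (x k)) * (NormedSpace.exp (∑ k, X k (x k))).trace.re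
      ≤ Real.exp (Fintype.card ι * (c ^ 2 / 2)) * Fintype.card κ := by
  let e := Fintype.equivFin ι
  have h1 := sum_prod_re_trace_exp_le_fin hc _ (fun k => h (e.symm k)) (H := 0) isHermitian_zero
  rw [Real.exp_nat_mul]
  rw [← (e.arrowCongr (Equiv.refl β)).sum_comp] at h1
  simp only [Equiv.arrowCongr_apply, Equiv.coe_refl, Function.comp, id, zero_add,
    NormedSpace.exp_zero, trace_one, Complex.natCast_re] at h1
  have h2 : ∀ x : ι → β, ∏ k, p (e.symm k) (x (e.symm k)) = ∏ k, p k (x k) := fun x =>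
    e.symm.prod_comp fun k => p k (x k)
  have h3 : ∀ x : ι → β, ∑ k, X (e.symm k) (x (e.symm k)) = ∑ k, X k (x k) := fun x =>
    e.symm.sum_comp fun k => X k (x k)
  simp only [h2, h3] at h1
  exact h1

open Classical in
/-- A matrix Hoeffding inequality for the largest eigenvalue of a sum of independent centred
bounded Hermitian matrices, in terms of their joint distribution. -/
theorem sum_prod_not_posSemidef_le [Nonempty κ] {c s : ℝ} (hc : 0 < c) (hs : 0 < s) (t : ℝ)
    {p : ι → β → ℝ} {X : ι → β → Matrix κ κ ℂ} (h : ∀ k, IsCentredBounded (p k) (X k) c) :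
    ∑ x : ι → β with ¬ ((t : ℂ) • 1 - ∑ k, X k (x k)).PosSemidef, ∏ k, p k (x k)
      ≤ Fintype.card κ * Real.exp (Fintype.card ι * ((s * c) ^ 2 / 2) - s * t) := by
  have h1 := sum_prod_re_trace_exp_le (mul_pos hs hc) fun k => (h k).smul hs.le
  have hp : ∀ x : ι → β, 0 ≤ ∏ k, p k (x k) := fun x =>
    Finset.prod_nonneg fun k _ => (h k).nonneg _
  have hH : ∀ x : ι → β, (∑ k, (s : ℂ) • X k (x k)).IsHermitian := fun x =>
    isSelfAdjoint_sum _ fun k _ => ((h k).smul hs.le).isHermitian (x k)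
  have htr : ∀ x : ι → β, (NormedSpace.exp (∑ k, (s : ℂ) • X k (x k))).trace.re
      = ∑ i, Real.exp ((hH x).eigenvalues i) := fun x => by
    rw [exp_eq_spectralMatrix (hH x), trace_spectralMatrix]
    simp only [Complex.re_sum, Complex.ofReal_re]
  -- Failure of the semidefinite bound means that an eigenvalue of the scaled sum exceeds st, and it
  -- alone contributes more than exp(st) to the trace. The rest is Markov's inequality.
  have h2 : ∀ x : ι → β, ¬ ((t : ℂ) • 1 - ∑ k, X k (x k)).PosSemidef →
      Real.exp (s * t) ≤ (NormedSpace.exp (∑ k, (s : ℂ) • X k (x k))).trace.re := fun x hx => by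
    have h3 : ¬ ((((s * t : ℝ)) : ℂ) • 1 - ∑ k, (s : ℂ) • X k (x k)).PosSemidef := fun h4 => by
      refine hx ?_
      have h5 := h4.smul (Complex.zero_le_real.2 (inv_nonneg.2 hs.le))
      rwa [← Finset.smul_sum, Complex.ofReal_mul, mul_smul, ← smul_sub, smul_smul,
        ← Complex.ofReal_mul, inv_mul_cancel₀ hs.ne', Complex.ofReal_one, one_smul] at h5
    rw [posSemidef_smul_one_sub_iff (hH x)] at h3
    push Not at h3
    obtain ⟨i, hi⟩ := h3
    rw [htr]
    exact (Real.exp_le_exp.2 hi.le).trans (Finset.single_le_sum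
      (f := fun i => Real.exp ((hH x).eigenvalues i)) (fun i _ => (Real.exp_pos _).le)
      (Finset.mem_univ i))
  rw [Real.exp_sub, mul_div_assoc', le_div_iff₀ (Real.exp_pos _), Finset.sum_mul]
  calc _ ≤ ∑ x : ι → β with ¬ ((t : ℂ) • 1 - ∑ k, X k (x k)).PosSemidef,
        (∏ k, p k (x k)) * (NormedSpace.exp (∑ k, (s : ℂ) • X k (x k))).trace.re :=
        Finset.sum_le_sum fun x hx => mul_le_mul_of_nonneg_left
          (h2 x (Finset.mem_filter.1 hx).2) (hp x)
    _ ≤ ∑ x : ι → β, (∏ k, p k (x k))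
          * (NormedSpace.exp (∑ k, (s : ℂ) • X k (x k))).trace.re := by
        refine Finset.sum_le_sum_of_subset_of_nonneg (Finset.filter_subset _ _) fun x _ _ => ?_
        refine mul_nonneg (hp x) ?_
        rw [htr]
        exact Finset.sum_nonneg fun i _ => (Real.exp_pos _).le
    _ ≤ _ := h1
    _ = _ := mul_comm _ _

end MatrixHoeffding

/-! ### Algebra of n-fold Kronecker products. -/

section Tensor

variable {n : ℕ}

theorem tensor_mul (A B : Fin n → Matrix (Fin 2) (Fin 2) ℂ) :
    tensor A * tensor B = tensor fun k => A k * B k := by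
  ext i j
  simp only [tensor, Matrix.mul_apply, Matrix.of_apply, ← Finset.prod_mul_distrib]
  exact (Fintype.prod_sum fun k l => A k (i k) l * B k l (j k)).symm

theorem tensor_conjTranspose (A : Fin n → Matrix (Fin 2) (Fin 2) ℂ) :
    (tensor A)ᴴ = tensor fun k => (A k)ᴴ := by
  ext i j
  simp [tensor, Matrix.conjTranspose_apply]

theorem tensor_sum {S : Type*} [Fintype S] (f : Fin n → S → Matrix (Fin 2) (Fin 2) ℂ) :
    tensor (fun k => ∑ s, f k s) = ∑ s : Fin n → S, tensor fun k => f k (s k) := by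
  ext i j
  simp only [tensor, Matrix.of_apply, Matrix.sum_apply]
  exact Fintype.prod_sum fun k s => f k s (i k) (j k)

theorem tensor_smul (c : Fin n → ℂ) (A : Fin n → Matrix (Fin 2) (Fin 2) ℂ) :
    tensor (fun k => c k • A k) = (∏ k, c k) • tensor A := by
  ext i j
  simp [tensor, Finset.prod_mul_distrib]

theorem tensor_one : tensor (fun _ : Fin n => (1 : Matrix (Fin 2) (Fin 2) ℂ)) = 1 := by
  ext i j
  simp [tensor, Matrix.one_apply, Finset.prod_ite_zero, funext_iff]

end Tensor

theorem sum_intUnits {M : Type*} [AddCommMonoid M] (f : ℤˣ → M) : ∑ s, f s = f 1 + f (-1) := by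
  rw [show (Finset.univ : Finset ℤˣ) = {1, -1} from rfl, Finset.sum_pair (by decide)]

theorem sum_axis {M : Type*} [AddCommMonoid M] (f : Axis → M) :
    ∑ t, f t = f Axis.x + (f Axis.y + f Axis.z) := by
  rw [show (Finset.univ : Finset Axis) = {Axis.x, Axis.y, Axis.z} from rfl,
    Finset.sum_insert (by decide), Finset.sum_pair (by decide)]

theorem sum_proj (t : Axis) : ∑ s, proj t s = 1 := by
  rw [sum_intUnits]
  simp only [proj, Units.val_one, Units.val_neg, Int.cast_one, Int.cast_neg]
  module

/-! ### The linear estimator as a sum of single-measurement snapshots. -/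

section Snapshot

variable {n : ℕ}

/-- The contribution `⊗ⱼ (I/6 + rⱼ σ_{aⱼ}/2)` of one outcome `r` of the setting `a` to the linear
estimator. -/
noncomputable def snapshot (a : Setting n) (r : Outcome n) : QMat n :=
  tensor fun k => (1 / 6 : ℂ) • 1 + (((r k : ℤ) : ℂ) / 2) • pauli (some (a k))

theorem posSemidef_outcomeProj (a : Setting n) (r : Outcome n) : (outcomeProj a r).PosSemidef := by
  have h : outcomeProj a r = (outcomeProj a r)ᴴ * outcomeProj a r := by
    rw [outcomeProj, tensor_conjTranspose, tensor_mul]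
    simp only [(proj_isHermitian _ _).eq, proj_mul_self]
  rw [h]
  exact posSemidef_conjTranspose_mul_self _

theorem sum_outcomeProj (a : Setting n) : ∑ r, outcomeProj a r = 1 := by
  rw [← tensor_one, ← funext (f := fun k : Fin n => ∑ s, proj (a k) s) fun k => sum_proj (a k),
    tensor_sum]
  rfl

/-- This is the spectral decomposition in the measured basis. Each factor has eigenvalue 1/6 + 1/2 =
2/3 when s agrees with r and 1/6 - 1/2 = -1/3 otherwise, whence the operator bound (2/3)ⁿ. -/
theorem snapshot_eq_sum (a : Setting n) (r : Outcome n) :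
    snapshot a r = ∑ s : Outcome n,
      ((∏ k, (1 / 6 + ((r k : ℤ) : ℝ) * ((s k : ℤ) : ℝ) / 2) : ℝ) : ℂ) • outcomeProj a s := by
  have h : ∀ k, (1 / 6 : ℂ) • 1 + (((r k : ℤ) : ℂ) / 2) • pauli (some (a k))
      = ∑ s : ℤˣ, (1 / 6 + ((r k : ℤ) : ℂ) * ((s : ℤ) : ℂ) / 2) • proj (a k) s := fun k => by
    rw [sum_intUnits]
    simp only [proj, Units.val_one, Units.val_neg, Int.cast_one, Int.cast_neg]
    module
  simp only [snapshot, h]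
  rw [tensor_sum]
  refine Finset.sum_congr rfl fun s _ => ?_
  rw [tensor_smul]
  push_cast
  rfl

theorem abs_prod_snapshot_coeff_le (r s : Outcome n) :
    |∏ k, (1 / 6 + ((r k : ℤ) : ℝ) * ((s k : ℤ) : ℝ) / 2)| ≤ (2 / 3) ^ n := by
  rw [Finset.abs_prod]
  refine (Finset.prod_le_prod (g := fun _ => (2 / 3 : ℝ)) (fun _ _ => abs_nonneg _)
    fun k _ => ?_).trans_eq
      (by rw [Finset.prod_const, Finset.card_univ, Fintype.card_fin])
  rcases Int.units_eq_one_or (r k) with h | h <;> rcases Int.units_eq_one_or (s k) with h' | h' <;>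
    rw [h, h'] <;> norm_num [abs_le]

theorem posSemidef_sub_snapshot (a : Setting n) (r : Outcome n) :
    ((((2 / 3) ^ n : ℝ) : ℂ) • 1 - snapshot a r).PosSemidef := by
  rw [snapshot_eq_sum, ← sum_outcomeProj a, Finset.smul_sum, ← Finset.sum_sub_distrib]
  refine posSemidef_sum _ fun s _ => ?_
  rw [← sub_smul, ← Complex.ofReal_sub]
  exact (posSemidef_outcomeProj a s).smul (Complex.zero_le_real.2
    (sub_nonneg.2 (abs_le.1 (abs_prod_snapshot_coeff_le r s)).2))

theorem posSemidef_add_snapshot (a : Setting n) (r : Outcome n) :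
    ((((2 / 3) ^ n : ℝ) : ℂ) • 1 + snapshot a r).PosSemidef := by
  rw [snapshot_eq_sum, ← sum_outcomeProj a, Finset.smul_sum, ← Finset.sum_add_distrib]
  refine posSemidef_sum _ fun s _ => ?_
  rw [← add_smul, ← Complex.ofReal_add]
  refine (posSemidef_outcomeProj a s).smul (Complex.zero_le_real.2 ?_)
  linarith [(abs_le.1 (abs_prod_snapshot_coeff_le r s)).1]

theorem isHermitian_snapshot (a : Setting n) (r : Outcome n) : (snapshot a r).IsHermitian := by
  have h := (posSemidef_add_snapshot a r).1
  have h1 : ((((2 / 3) ^ n : ℝ) : ℂ) • (1 : QMat n)).IsHermitian := by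
    simp only [Matrix.IsHermitian, conjTranspose_smul, conjTranspose_one, Complex.star_def,
      Complex.conj_ofReal]
  simpa using h.sub h1

/-- Expand the tensor product, writing 1/6 as (1/2)(1/3): every position gives a factor 1/2 and
every label I a further 1/3, which is the normalization of `coefHat`. -/
theorem snapshot_eq_sum_pauliString (a : Setting n) (r : Outcome n) :
    snapshot a r = ∑ b : PauliLabel n,
      ((1 / (3 ^ numI b * 2 ^ n : ℝ) * designMatrix n (r, a) b : ℝ) : ℂ) • pauliString b := by
  have h : ∀ k, (1 / 6 : ℂ) • 1 + (((r k : ℤ) : ℂ) / 2) • pauli (some (a k))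
      = ∑ l : Option Axis, ((1 / 2 * (if l = none then 1 / 3 else 1) *
          (if l ≠ none then ((r k : ℤ) : ℝ) * (if l = some (a k) then 1 else 0) else 1) : ℝ) : ℂ)
          • pauli l := fun k => by
    rw [Fintype.sum_option, sum_axis]
    rw [show pauli none = 1 from rfl]
    cases a k <;> simp <;> module
  simp only [snapshot, h]
  rw [tensor_sum]
  refine Finset.sum_congr rfl fun b _ => ?_
  rw [tensor_smul, ← Complex.ofReal_prod]
  congr 2
  rw [Finset.prod_mul_distrib, Finset.prod_mul_distrib, designMatrix, Matrix.of_apply,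
    Finset.prod_filter, numI]
  congr 1
  rw [Finset.prod_ite]
  simp [mul_comm]

theorem rhoHat_eq_sum_snapshot {m : ℕ} (x : Setting n → Fin m → Outcome n) :
    rhoHat x = ∑ ai : Setting n × Fin m, ((1 / m : ℝ) : ℂ) • snapshot ai.1 (x ai.1 ai.2) := by
  have h : ∀ b, coefHat x b = ∑ ai : Setting n × Fin m,
      1 / m * (1 / (3 ^ numI b * 2 ^ n : ℝ) * designMatrix n (x ai.1 ai.2, ai.1) b) := fun b => by
    simp only [coefHat, pHat, Fintype.sum_prod_type]
    rw [Finset.sum_comm, Finset.mul_sum]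
    refine Finset.sum_congr rfl fun a _ => ?_
    simp only [mul_assoc, Finset.sum_mul]
    simp only [← Finset.mul_sum]
    rw [Finset.sum_comm]
    simp only [ite_mul, one_mul, zero_mul, Finset.sum_ite_eq, Finset.mem_univ, if_true]
    ring
  simp only [rhoHat, h, snapshot_eq_sum_pauliString, Finset.smul_sum]
  rw [Finset.sum_comm]
  refine Finset.sum_congr rfl fun b _ => ?_
  rw [Complex.ofReal_sum, Finset.sum_smul]
  refine Finset.sum_congr rfl fun ai _ => ?_
  rw [smul_smul, Complex.ofReal_mul]

/-- The linear inversion formula: the average of the snapshots over the Born probabilities,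
summed over all settings, recovers the matrix. -/
theorem sum_trace_smul_snapshot (ρ : QMat n) :
    ∑ a : Setting n, ∑ r : Outcome n, (ρ * outcomeProj a r).trace • snapshot a r = ρ := by
  -- One-qubit inversion in coordinates: pairing projectors with snapshots yields the kernel of the
  -- identity map. The n-qubit kernel `h2` is the product of these.
  have h1 : ∀ k l i j : Fin 2, ∑ t : Axis, ∑ s : ℤˣ, proj t s k l *
      ((1 / 6 : ℂ) • 1 + (((s : ℤ) : ℂ) / 2) • pauli (some t) : Matrix (Fin 2) (Fin 2) ℂ) i j
        = if l = i ∧ k = j then 1 else 0 := by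
    intro k l i j
    simp only [sum_axis, sum_intUnits]
    fin_cases k <;> fin_cases l <;> fin_cases i <;> fin_cases j <;>
      simp [proj, pauli] <;> ring_nf <;> simp <;> norm_num
  have h2 : ∀ k l i j : Idx n, ∑ a : Setting n, ∑ r : Outcome n,
      outcomeProj a r k l * snapshot a r i j = if l = i ∧ k = j then 1 else 0 := by
    intro k l i j
    simp only [outcomeProj, snapshot, tensor, Matrix.of_apply, ← Finset.prod_mul_distrib]
    have h3 : ∀ a : Setting n, ∑ r : Outcome n, ∏ q, (proj (a q) (r q) (k q) (l q) *
        ((1 / 6 : ℂ) • 1 + (((r q : ℤ) : ℂ) / 2) • pauli (some (a q)) :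
          Matrix (Fin 2) (Fin 2) ℂ) (i q) (j q)) = ∏ q, ∑ s : ℤˣ, (proj (a q) s (k q) (l q) *
        ((1 / 6 : ℂ) • 1 + (((s : ℤ) : ℂ) / 2) • pauli (some (a q)) :
          Matrix (Fin 2) (Fin 2) ℂ) (i q) (j q)) := fun a =>
      (Fintype.prod_sum fun q s => (proj (a q) s (k q) (l q) *
        ((1 / 6 : ℂ) • 1 + (((s : ℤ) : ℂ) / 2) • pauli (some (a q)) :
          Matrix (Fin 2) (Fin 2) ℂ) (i q) (j q))).symm
    simp only [h3]
    rw [← Fintype.prod_sum fun q t => ∑ s : ℤˣ, (proj t s (k q) (l q) *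
        ((1 / 6 : ℂ) • 1 + (((s : ℤ) : ℂ) / 2) • pauli (some t) :
          Matrix (Fin 2) (Fin 2) ℂ) (i q) (j q))]
    simp only [h1, Finset.prod_ite_zero, Finset.prod_const_one, Finset.mem_univ, true_implies,
      funext_iff, ← forall_and]
  ext i j
  simp only [Matrix.sum_apply, Matrix.smul_apply, smul_eq_mul, Matrix.trace, Matrix.diag,
    Matrix.mul_apply, Finset.sum_mul]
  calc _ = ∑ l, ∑ k, ρ l k * ∑ a : Setting n, ∑ r : Outcome n,
        outcomeProj a r k l * snapshot a r i j := by
        simp only [Finset.mul_sum]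
        rw [Finset.sum_congr rfl fun a _ => Finset.sum_comm, Finset.sum_comm]
        refine Finset.sum_congr rfl fun l _ => ?_
        rw [Finset.sum_congr rfl fun a _ => Finset.sum_comm, Finset.sum_comm]
        simp only [mul_assoc]
    _ = ρ i j := by
        simp only [h2, mul_ite, mul_one, mul_zero]
        rw [Finset.sum_eq_single i, Finset.sum_eq_single j] <;> simp +contextual

end Snapshot

/-! ### From independence on Ω to finite sums over outcomes. -/

section FiniteIndependence

variable {Ω : Type*} [MeasurableSpace Ω] {P : Measure Ω} {ι β : Type*} [Fintype ι]
  [MeasurableSpace β] [MeasurableSingletonClass β]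

theorem measureReal_forall_eq [IsProbabilityMeasure P] {Y : ι → Ω → β} (hY : iIndepFun Y P)
    (x : ι → β) : P.real {ω | ∀ k, Y k ω = x k} = ∏ k, P.real {ω | Y k ω = x k} := by
  have h := hY.measure_inter_preimage_eq_mul Finset.univ (sets := fun k => {x k})
    fun k _ => measurableSet_singleton _
  have e : {ω | ∀ k, Y k ω = x k} = ⋂ k ∈ Finset.univ, Y k ⁻¹' {x k} := by ext; simp
  rw [Measure.real, e, h, ENNReal.toReal_prod]
  rfl

/-- Passes from an event on Ω to the product weights of the Hoeffding bound. A union bound over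
outcome tuples suffices, so measurability of the event plays no role. -/
theorem measureReal_le_sum_prod [IsProbabilityMeasure P] [Fintype β] [DecidableEq ι] {Y : ι → Ω → β}
    (hY : iIndepFun Y P) (B : (ι → β) → Prop)
    [DecidablePred B] :
    P.real {ω | B fun k => Y k ω} ≤ ∑ x : ι → β with B x, ∏ k, P.real {ω | Y k ω = x k} := by
  have h : {ω | B fun k => Y k ω}
      ⊆ ⋃ x ∈ Finset.univ.filter B, {ω | ∀ k, Y k ω = x k} := fun ω hω => by
    simp only [Finset.mem_filter, Finset.mem_univ, true_and, Set.mem_iUnion]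
    exact ⟨_, hω, fun _ => rfl⟩
  refine (measureReal_mono h (measure_ne_top P _)).trans ((measureReal_biUnion_finset_le _ _).trans_eq ?_)
  exact Finset.sum_congr rfl fun x _ => measureReal_forall_eq hY x

end FiniteIndependence

/-! ### Operator-norm concentration of the linear estimator. -/

section Concentration

variable {n m : ℕ} {ρ : QMat n}

/-- The probability `Tr(ρ P_r^a)` of the outcome `r` of the setting `a`. -/
noncomputable def bornProb (ρ : QMat n) (a : Setting n) (r : Outcome n) : ℝ :=
  (ρ * outcomeProj a r).trace.re

theorem ofReal_bornProb (hρ : ρ.PosSemidef) (a : Setting n) (r : Outcome n) :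
    (bornProb ρ a r : ℂ) = (ρ * outcomeProj a r).trace := by
  refine Complex.ext rfl ?_
  have h : star (ρ * outcomeProj a r).trace = (ρ * outcomeProj a r).trace := by
    rw [← trace_conjTranspose, conjTranspose_mul, hρ.1.eq, (posSemidef_outcomeProj a r).1.eq,
      trace_mul_comm]
  exact (Complex.conj_eq_iff_im.1 h).symm

theorem sum_bornProb (hρ : IsDensity ρ) (a : Setting n) : ∑ r, bornProb ρ a r = 1 := by
  simp only [bornProb, ← Complex.re_sum, ← trace_sum, ← Finset.mul_sum, sum_outcomeProj, mul_one,
    hρ.2, Complex.one_re]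

/-- The expectation of the snapshot of one measurement of the setting `a`. -/
noncomputable def meanSnapshot (ρ : QMat n) (a : Setting n) : QMat n :=
  ∑ r, (bornProb ρ a r : ℂ) • snapshot a r

theorem sum_meanSnapshot (hρ : ρ.PosSemidef) : ∑ a, meanSnapshot ρ a = ρ := by
  simp only [meanSnapshot, ofReal_bornProb hρ]
  exact sum_trace_smul_snapshot ρ

theorem bornProb_nonneg (hρ : ρ.PosSemidef) (a : Setting n) (r : Outcome n) :
    0 ≤ bornProb ρ a r :=
  re_trace_mul_nonneg hρ (posSemidef_outcomeProj a r)

/-- The factor 2 is the price of centring: the mean, a convex combination of snapshots, obeys the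
same bound (2/3)ⁿ. -/
theorem isCentredBounded_snapshot (hρ : IsDensity ρ) (a : Setting n) :
    IsCentredBounded (bornProb ρ a) (fun r => snapshot a r - meanSnapshot ρ a)
      (2 * (2 / 3) ^ n) := by
  have hp : ∑ r, (bornProb ρ a r : ℂ) = 1 := by exact_mod_cast sum_bornProb hρ a
  have hH : (meanSnapshot ρ a).IsHermitian := isSelfAdjoint_sum _ fun r _ => by
    simp only [IsSelfAdjoint, star_eq_conjTranspose, conjTranspose_smul,
      (isHermitian_snapshot a r).eq, Complex.star_def, Complex.conj_ofReal]
  have h1 : ((((2 / 3) ^ n : ℝ) : ℂ) • 1 - meanSnapshot ρ a).PosSemidef := by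
    have e : (((2 / 3) ^ n : ℝ) : ℂ) • 1 - meanSnapshot ρ a
        = ∑ r, (bornProb ρ a r : ℂ) • ((((2 / 3) ^ n : ℝ) : ℂ) • 1 - snapshot a r) := by
      simp only [smul_sub, Finset.sum_sub_distrib, ← Finset.sum_smul, hp, one_smul, meanSnapshot]
    rw [e]
    exact posSemidef_sum _ fun r _ => (posSemidef_sub_snapshot a r).smul
      (Complex.zero_le_real.2 (bornProb_nonneg hρ.1 a r))
  have h2 : ((((2 / 3) ^ n : ℝ) : ℂ) • 1 + meanSnapshot ρ a).PosSemidef := by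
    have e : (((2 / 3) ^ n : ℝ) : ℂ) • 1 + meanSnapshot ρ a
        = ∑ r, (bornProb ρ a r : ℂ) • ((((2 / 3) ^ n : ℝ) : ℂ) • 1 + snapshot a r) := by
      simp only [smul_add, Finset.sum_add_distrib, ← Finset.sum_smul, hp, one_smul, meanSnapshot]
    rw [e]
    exact posSemidef_sum _ fun r _ => (posSemidef_add_snapshot a r).smul
      (Complex.zero_le_real.2 (bornProb_nonneg hρ.1 a r))
  refine ⟨bornProb_nonneg hρ.1 a, sum_bornProb hρ a, fun r => (isHermitian_snapshot a r).sub hH,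
    ?_, fun r => ?_, fun r => ?_⟩
  · simp only [smul_sub, Finset.sum_sub_distrib, ← Finset.sum_smul, hp, one_smul]
    exact sub_self _
  · convert (posSemidef_sub_snapshot a r).add h2 using 1
    push_cast
    module
  · convert (posSemidef_add_snapshot a r).add h1 using 1
    push_cast
    module

theorem rhoHat_sub_eq_sum (hm : 1 ≤ m) (hρ : ρ.PosSemidef) (x : Setting n → Fin m → Outcome n) :
    rhoHat x - ρ = ∑ ai : Setting n × Fin m,
      ((1 / m : ℝ) : ℂ) • (snapshot ai.1 (x ai.1 ai.2) - meanSnapshot ρ ai.1) := by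
  have hm' : (m : ℂ) ≠ 0 := by exact_mod_cast (by omega : m ≠ 0)
  have h : ∑ ai : Setting n × Fin m, ((1 / m : ℝ) : ℂ) • meanSnapshot ρ ai.1 = ρ := by
    rw [Fintype.sum_prod_type]
    simp only [Finset.sum_const, Finset.card_univ, Fintype.card_fin, ← Nat.cast_smul_eq_nsmul ℂ,
      smul_smul]
    push_cast
    simp only [mul_one_div_cancel hm', one_smul]
    exact sum_meanSnapshot hρ
  simp only [smul_sub, Finset.sum_sub_distrib]
  rw [h, rhoHat_eq_sum_snapshot]

/-- With no qubits there is only one outcome, hence no randomness. This case is separate because the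
final union bound relies on 2ⁿ ≥ 2. -/
theorem rhoHat_eq_of_zero (hm : 1 ≤ m) {ρ : QMat 0} (hρ : IsDensity ρ)
    (x : Setting 0 → Fin m → Outcome 0) : rhoHat x = ρ := by
  rw [← sub_eq_zero, rhoHat_sub_eq_sum hm hρ.1]
  refine Finset.sum_eq_zero fun ai _ => ?_
  have h := sum_bornProb hρ ai.1
  have e : meanSnapshot ρ ai.1 = snapshot ai.1 (x ai.1 ai.2) := by
    rw [Fintype.sum_subsingleton _ (x ai.1 ai.2)] at h
    rw [meanSnapshot, Fintype.sum_subsingleton _ (x ai.1 ai.2), h, Complex.ofReal_one, one_smul]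
  rw [e, sub_self, smul_zero]

theorem exp_mul_log_two_sub_log {ε : ℝ} (hε : 0 < ε) :
    Real.exp (n * Real.log 2 - Real.log ε) = 2 ^ n / ε := by
  rw [Real.exp_sub, Real.exp_log hε, Real.exp_nat_mul, Real.exp_log two_pos]

theorem logDim_pos (n : ℕ) {ε : ℝ} (hε0 : 0 < ε) (hε1 : ε < 1) :
    0 < n * Real.log 2 - Real.log ε := by
  have := Real.log_neg hε0 hε1
  have := Real.log_pos one_lt_two
  have : 0 ≤ n * Real.log 2 := by positivity
  linarith

/-- There are N = 3ⁿm summands bounded by c = 2(2/3)ⁿ/m, so Nc² = 4(4/3)ⁿ/m. The choice s = t/(Nc²)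
minimizes N(sc)²/2 - st, with value -t²/(2Nc²) = -4L. -/
theorem hoeffding_exponent {m t L : ℝ} (hm : 0 < m) (ht : t ^ 2 = 32 * (4 / 3) ^ n * (L / m)) :
    3 ^ n * m * ((t * m / (4 * (4 / 3) ^ n) * (1 / m * (2 * (2 / 3) ^ n))) ^ 2 / 2)
      - t * m / (4 * (4 / 3) ^ n) * t = -(4 * L) := by
  have h1 : ((2 / 3 : ℝ) ^ n) ^ 2 * 3 ^ n = (4 / 3) ^ n := by
    rw [← pow_mul, mul_comm n 2, pow_mul, ← mul_pow]; norm_num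
  have h2 : (0 : ℝ) < (4 / 3) ^ n := by positivity
  generalize (4 / 3 : ℝ) ^ n = G at *
  generalize (2 / 3 : ℝ) ^ n = a at *
  generalize (3 : ℝ) ^ n = b at *
  have h3 : b * m * ((t * m / (4 * G) * (1 / m * (2 * a))) ^ 2 / 2) - t * m / (4 * G) * t
      = t ^ 2 * m * (a ^ 2 * b) / (8 * G ^ 2) - t ^ 2 * m / (4 * G) := by
    field_simp
    ring
  rw [h3, h1, ht]
  field_simp
  ring

variable {Ω : Type*} [MeasurableSpace Ω] (P : Measure Ω) [IsProbabilityMeasure P]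
  (R : Setting n → Fin m → Ω → Outcome n)

/-- The deviation of the linear estimator in operator norm. -/
theorem measureReal_rhoHat_deviation_lt (hm : 1 ≤ m) (hρ : IsDensity ρ) (hR : IsSample P ρ R)
    {ε t : ℝ} (hε0 : 0 < ε) (hε1 : ε < 1) (ht : 0 < t)
    (htsq : t ^ 2 = 32 * (4 / 3) ^ n * ((n * Real.log 2 - Real.log ε) / m)) :
    P.real {ω | ¬ (((t : ℂ) • 1 - (rhoHat (fun a i => R a i ω) - ρ)).PosSemidef ∧
      ((t : ℂ) • 1 + (rhoHat (fun a i => R a i ω) - ρ)).PosSemidef)} < ε := by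
  classical
  rcases Nat.eq_zero_or_pos n with rfl | hn
  · have h : ((t : ℂ) • (1 : QMat 0)).PosSemidef := PosSemidef.one.smul (Complex.zero_le_real.2 ht.le)
    simpa only [rhoHat_eq_of_zero hm hρ, sub_self, sub_zero, add_zero, h, and_self, not_true,
      Set.ofPred_false, measureReal_empty] using hε0
  have hm' : (0 : ℝ) < m := by exact_mod_cast hm
  have hs : 0 < t * m / (4 * (4 / 3) ^ n) := by positivity
  have hL := exp_mul_log_two_sub_log (n := n) hε0
  generalize n * Real.log 2 - Real.log ε = L at htsq hL
  let X : Setting n × Fin m → Outcome n → QMat n := fun ai r =>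
    ((1 / m : ℝ) : ℂ) • (snapshot ai.1 r - meanSnapshot ρ ai.1)
  have hX : ∀ ai, IsCentredBounded (bornProb ρ ai.1) (X ai) (1 / m * (2 * (2 / 3) ^ n)) :=
    fun ai => (isCentredBounded_snapshot hρ ai.1).smul (by positivity)
  have hc : (0 : ℝ) < 1 / m * (2 * (2 / 3) ^ n) := by positivity
  have hlaw : ∀ ai : Setting n × Fin m, ∀ r, P.real {ω | R ai.1 ai.2 ω = r} = bornProb ρ ai.1 r :=
    fun ai r => by
      have h := hR.law ai.1 ai.2 r
      rw [← ofReal_bornProb hρ.1] at h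
      exact_mod_cast h
  have hcardA : Fintype.card Axis = 3 := rfl
  have hval : (Fintype.card (Setting n × Fin m) : ℝ) * ((t * m / (4 * (4 / 3) ^ n)
      * (1 / m * (2 * (2 / 3) ^ n))) ^ 2 / 2) - t * m / (4 * (4 / 3) ^ n) * t = -(4 * L) := by
    simp only [Fintype.card_prod, Fintype.card_pi, hcardA, Fintype.card_fin, Finset.prod_const,
      Finset.card_univ]
    push_cast
    exact hoeffding_exponent hm' htsq
  have hbound : (Fintype.card (Idx n) : ℝ) * Real.exp (-(4 * L)) = 2 ^ n * (ε / 2 ^ n) ^ 4 := by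
    have h : Real.exp (-(4 * L)) = (Real.exp L)⁻¹ ^ 4 := by
      rw [← Real.exp_neg, ← Real.exp_nat_mul]
      congr 1
      push_cast
      ring
    rw [h, hL, inv_div]
    simp
  have h1 := sum_prod_not_posSemidef_le hc hs t hX
  -- The lower tail is the upper tail of the negated summands.
  have h2 := sum_prod_not_posSemidef_le hc hs t fun ai => (hX ai).neg
  rw [hval, hbound] at h1 h2
  have key := fun B [DecidablePred B] => measureReal_le_sum_prod (P := P) hR.indep B
  simp only [hlaw] at key
  have k1 := (key fun x => ¬ ((t : ℂ) • 1 - ∑ ai, X ai (x ai)).PosSemidef).trans h1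
  have k2 := (key fun x => ¬ ((t : ℂ) • 1 - ∑ ai, -X ai (x ai)).PosSemidef).trans h2
  have hS : ∀ ω, ∑ ai, X ai (R ai.1 ai.2 ω) = rhoHat (fun a i => R a i ω) - ρ := fun ω =>
    (rhoHat_sub_eq_sum hm hρ.1 fun a i => R a i ω).symm
  simp only [Finset.sum_neg_distrib, sub_neg_eq_add, hS] at k1 k2
  refine (measureReal_mono (s₂ := {ω | ¬ ((t : ℂ) • 1 - (rhoHat (fun a i => R a i ω) - ρ)).PosSemidef}
    ∪ {ω | ¬ ((t : ℂ) • 1 + (rhoHat (fun a i => R a i ω) - ρ)).PosSemidef})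
    (fun ω hω => not_and_or.1 hω) (measure_ne_top P _)).trans_lt ?_
  refine (measureReal_union_le _ _).trans_lt ((add_le_add k1 k2).trans_lt ?_)
  -- The two tails total 2·2ⁿ(ε/2ⁿ)⁴ = 2ε(ε/2ⁿ)³ ≤ ε/4, since ε/2ⁿ ≤ 1/2.
  have h2n : (2 : ℝ) ≤ 2 ^ n := le_self_pow₀ one_le_two (by omega)
  have hu0 : 0 < ε / 2 ^ n := by positivity
  have hu1 : ε / 2 ^ n ≤ 1 / 2 := by
    rw [div_le_div_iff₀ (by positivity) two_pos]
    nlinarith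
  have hu3 : (ε / 2 ^ n) ^ 3 ≤ (1 / 2) ^ 3 := pow_le_pow_left₀ hu0.le hu1 3
  have hu4 : (2 : ℝ) ^ n * (ε / 2 ^ n) ^ 4 = ε * (ε / 2 ^ n) ^ 3 := by
    field_simp
  rw [hu4]
  nlinarith

end Concentration

variable {n : ℕ}

/-! ### Frobenius norm, trace duality and trace norm. -/

section Frobenius

theorem frobSq_eq_sum (A : QMat n) : frobSq A = ∑ i, ∑ j, ‖A i j‖ ^ 2 := by
  rw [frobSq, Finset.sum_comm]
  simp only [Matrix.trace, Matrix.diag, Matrix.mul_apply, Matrix.conjTranspose_apply,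
    Complex.re_sum, Complex.star_def, mul_comm ((starRingEnd ℂ) _), Complex.mul_conj,
    Complex.normSq_eq_norm_sq, Complex.ofReal_re]

theorem frobSq_nonneg (A : QMat n) : 0 ≤ frobSq A := by
  rw [frobSq_eq_sum]; positivity

theorem frobSq_spectralMatrix {A : QMat n} (hA : A.IsHermitian) (f : Idx n → ℝ) :
    frobSq (spectralMatrix hA f) = ∑ i, f i ^ 2 := by
  rw [frobSq, (spectralMatrix_isHermitian hA f).eq, spectralMatrix_mul, trace_spectralMatrix]
  simp [sq]

theorem frobSq_sub {A B : QMat n} (hA : A.IsHermitian) (hB : B.IsHermitian) :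
    frobSq (A - B) = frobSq A + frobSq B - 2 * (A * B).trace.re := by
  simp only [frobSq, conjTranspose_sub, hA.eq, hB.eq, mul_sub, sub_mul, trace_sub, Complex.sub_re]
  rw [trace_mul_comm B A]
  ring

theorem frobSq_sub_le {A B : QMat n} (hA : A.IsHermitian) (hB : B.IsHermitian) :
    frobSq (A - B) ≤ (√(frobSq A) + √(frobSq B)) ^ 2 := by
  have h := norm_trace_mul_sq_le A B
  have hA' : (A * Aᴴ).trace.re = frobSq A := by rw [frobSq, hA.eq]
  have hB' : (B * Bᴴ).trace.re = frobSq B := by rw [frobSq, hB.eq]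
  rw [hA', hB'] at h
  have h1 : ‖(A * B).trace‖ ≤ √(frobSq A) * √(frobSq B) := by
    rw [← Real.sqrt_mul (frobSq_nonneg A)]
    exact Real.le_sqrt_of_sq_le h
  have h2 := (abs_le.1 (Complex.abs_re_le_norm (A * B).trace)).1
  rw [frobSq_sub hA hB, add_sq, Real.sq_sqrt (frobSq_nonneg A), Real.sq_sqrt (frobSq_nonneg B)]
  linarith

theorem frobSq_eq_sum_eigenvalues {A : QMat n} (hA : A.IsHermitian) :
    frobSq A = ∑ i, hA.eigenvalues i ^ 2 := by
  conv_lhs => rw [← spectralMatrix_eigenvalues hA]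
  exact frobSq_spectralMatrix hA _

/-- The duality of trace norm and operator norm, combined with the Cauchy-Schwarz inequality for
the nonzero eigenvalues. -/
theorem re_trace_mul_le {A E : QMat n} (hA : A.IsHermitian) {t : ℝ} (ht : 0 ≤ t)
    (h1 : ((t : ℂ) • 1 - E).PosSemidef) (h2 : ((t : ℂ) • 1 + E).PosSemidef) :
    (A * E).trace.re ≤ t * √(A.rank) * √(frobSq A) := by
  -- The positive part of A is paired with t·1 - E and the negative part with t·1 + E. Adding the
  -- two gives Tr(AE) ≤ t ∑|λᵢ|.
  have hpos := re_trace_mul_nonneg ((posSemidef_spectralMatrix_iff hA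
    fun i => max (hA.eigenvalues i) 0).2 fun i => le_max_right _ _) h1
  have hneg := re_trace_mul_nonneg ((posSemidef_spectralMatrix_iff hA
    fun i => max (-hA.eigenvalues i) 0).2 fun i => le_max_right _ _) h2
  have hAeq : A = spectralMatrix hA (fun i => max (hA.eigenvalues i) 0)
      - spectralMatrix hA (fun i => max (-hA.eigenvalues i) 0) := by
    conv_lhs => rw [← spectralMatrix_eigenvalues hA]
    rw [← spectralMatrix_sub]
    congr 1
    ext i
    rcases le_total (hA.eigenvalues i) 0 with h | h <;> simp [h]
  have htr : (spectralMatrix hA (fun i => max (hA.eigenvalues i) 0)).trace.re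
      + (spectralMatrix hA (fun i => max (-hA.eigenvalues i) 0)).trace.re
        = ∑ i, |hA.eigenvalues i| := by
    rw [trace_spectralMatrix, trace_spectralMatrix, Complex.re_sum, Complex.re_sum,
      ← Finset.sum_add_distrib]
    refine Finset.sum_congr rfl fun i _ => ?_
    simp only [Complex.ofReal_re]
    rcases le_total (hA.eigenvalues i) 0 with h | h <;> simp [h, abs_of_nonpos, abs_of_nonneg]
  have hcs : ∑ i, |hA.eigenvalues i| ≤ √(A.rank) * √(frobSq A) := by
    have h3 := Finset.sum_mul_sq_le_sq_mul_sq Finset.univ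
      (fun i => if hA.eigenvalues i ≠ 0 then (1 : ℝ) else 0) fun i => |hA.eigenvalues i|
    have h4 : ∑ i, (if hA.eigenvalues i ≠ 0 then (1 : ℝ) else 0) * |hA.eigenvalues i|
        = ∑ i, |hA.eigenvalues i| := Finset.sum_congr rfl fun i _ => by
      by_cases h : hA.eigenvalues i = 0 <;> simp [h]
    have h5 : ∑ i, (if hA.eigenvalues i ≠ 0 then (1 : ℝ) else 0) ^ 2 = A.rank := by
      rw [hA.rank_eq_card_non_zero_eigs, Fintype.card_subtype]
      simp only [ite_pow, one_pow, zero_pow two_ne_zero, Finset.sum_boole]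
    simp only [h4, h5, sq_abs] at h3
    rw [← frobSq_eq_sum_eigenvalues] at h3
    rw [← Real.sqrt_mul (Nat.cast_nonneg _)]
    exact Real.le_sqrt_of_sq_le h3
  simp only [mul_sub, mul_add, trace_sub, trace_add, Matrix.mul_smul, mul_one, trace_smul,
    smul_eq_mul, Complex.sub_re, Complex.add_re, Complex.re_ofReal_mul] at hpos hneg
  have e : (A * E).trace.re = (spectralMatrix hA (fun i => max (hA.eigenvalues i) 0) * E).trace.re
      - (spectralMatrix hA (fun i => max (-hA.eigenvalues i) 0) * E).trace.re := by
    conv_lhs => rw [hAeq]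
    rw [sub_mul, trace_sub, Complex.sub_re]
  have h6 := mul_le_mul_of_nonneg_left hcs ht
  rw [← htr] at h6
  rw [e, mul_assoc]
  linarith

/-- Cauchy-Schwarz over all 2ⁿ singular values; this factor turns (4/3)ⁿ into (8/3)ⁿ. -/
theorem traceNorm_sq_le (A : QMat n) : traceNorm A ^ 2 ≤ 2 ^ n * frobSq A := by
  have h := sq_sum_le_card_mul_sum_sq (s := Finset.univ)
    (f := fun i => √((Matrix.isHermitian_conjTranspose_mul_self A).eigenvalues i))
  have h1 : ∑ i, √((Matrix.isHermitian_conjTranspose_mul_self A).eigenvalues i) ^ 2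
      = frobSq A := by
    rw [frobSq, (Matrix.isHermitian_conjTranspose_mul_self A).trace_eq_sum_eigenvalues,
      Complex.re_sum]
    exact Finset.sum_congr rfl fun i _ =>
      Real.sq_sqrt (eigenvalues_conjTranspose_mul_self_nonneg A i)
  rw [h1] at h
  simpa [traceNorm] using h

end Frobenius

/-! ### The rank-penalized estimator: oracle inequality and existence. -/

section RankPenalty

variable {hat ρ T : QMat n}

theorem rank_sub_le (A B : QMat n) : (A - B).rank ≤ A.rank + B.rank := by
  refine (Submodule.finrank_mono (t := LinearMap.range A.mulVecLin ⊔ LinearMap.range B.mulVecLin)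
    ?_).trans (Submodule.finrank_add_le_finrank_add_finrank _ _)
  rintro _ ⟨v, rfl⟩
  rw [mulVecLin_apply, sub_mulVec]
  exact Submodule.sub_mem _ (Submodule.mem_sup_left ⟨v, rfl⟩) (Submodule.mem_sup_right ⟨v, rfl⟩)

/-- Here x and y stand for ‖T-ρ‖_F and ‖Q-ρ‖_F, and w for Tr((T-Q)E). Young's inequality with
weights 1 + θ/2 on x and θ/2 on y costs (1+θ)t²(rT + rQ) = ν(rT + rQ), which cancels rT and doubles
rQ. What remains is x²/c(θ) ≤ c(θ)y² + 2ν rQ. -/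
theorem oracle_arith {x y t θ ν rT rQ w : ℝ} (hθ : 0 < θ) (hν : ν = (1 + θ) * t ^ 2)
    (hr : 0 ≤ rT + rQ) (hmin : x ^ 2 + ν * rT ≤ y ^ 2 + 2 * w + ν * rQ)
    (hw : w ≤ t * √(rT + rQ) * (x + y)) :
    x ^ 2 ≤ cConst θ ^ 2 * y ^ 2 + 2 * cConst θ * ν * rQ := by
  have hs := Real.sq_sqrt hr
  set s := √(rT + rQ)
  have h3 : 2 * (t * s * x) ≤ x ^ 2 / (1 + θ / 2) + (1 + θ / 2) * (t * s) ^ 2 := by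
    have := two_mul_le_add_sq (x / √(1 + θ / 2)) (√(1 + θ / 2) * (t * s))
    rw [div_pow, mul_pow, Real.sq_sqrt (by positivity)] at this
    have h0 : √(1 + θ / 2) ≠ 0 := by positivity
    calc _ = 2 * (x / √(1 + θ / 2)) * (√(1 + θ / 2) * (t * s)) := by field_simp
      _ ≤ _ := this
  have h4 : 2 * (t * s * y) ≤ y ^ 2 / (θ / 2) + θ / 2 * (t * s) ^ 2 := by
    have := two_mul_le_add_sq (y / √(θ / 2)) (√(θ / 2) * (t * s))
    rw [div_pow, mul_pow, Real.sq_sqrt (by positivity)] at this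
    have h0 : √(θ / 2) ≠ 0 := by positivity
    calc _ = 2 * (y / √(θ / 2)) * (√(θ / 2) * (t * s)) := by field_simp
      _ ≤ _ := this
  have h5 : (t * s) ^ 2 = t ^ 2 * (rT + rQ) := by rw [mul_pow, hs]
  have h6 : x ^ 2 - x ^ 2 / (1 + θ / 2) ≤ cConst θ * y ^ 2 + 2 * ν * rQ := by
    have e : cConst θ * y ^ 2 = y ^ 2 + y ^ 2 / (θ / 2) := by
      rw [cConst]; field_simp
    rw [h5] at h3 h4
    rw [e, hν]
    rw [hν] at hmin
    linarith
  have h7 : x ^ 2 = cConst θ * (x ^ 2 - x ^ 2 / (1 + θ / 2)) := by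
    rw [cConst]
    field_simp
    ring
  have hc : 0 ≤ cConst θ := by rw [cConst]; positivity
  rw [h7]
  calc _ ≤ cConst θ * (cConst θ * y ^ 2 + 2 * ν * rQ) := mul_le_mul_of_nonneg_left h6 hc
    _ = _ := by ring

theorem IsRankPenalized.frobSq_sub_le {θ ν t : ℝ} (hT : IsRankPenalized hat ν T) (hθ : 0 < θ)
    (ht : 0 ≤ t) (hν : ν = (1 + θ) * t ^ 2) (hρ : ρ.IsHermitian)
    (h1 : ((t : ℂ) • 1 - (hat - ρ)).PosSemidef) (h2 : ((t : ℂ) • 1 + (hat - ρ)).PosSemidef)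
    {Q : QMat n} (hQ : Q.IsHermitian) :
    frobSq (T - ρ) ≤ cConst θ ^ 2 * frobSq (Q - ρ) + 2 * cConst θ * ν * Q.rank := by
  -- Semidefiniteness includes being Hermitian, so `h2` already forces this.
  have hE : (hat - ρ).IsHermitian := by
    have h3 : ((t : ℂ) • (1 : QMat n)).IsHermitian := by
      simp only [Matrix.IsHermitian, conjTranspose_smul, conjTranspose_one, Complex.star_def,
        Complex.conj_ofReal]
    simpa using h2.1.sub h3
  have hmin := hT.2 Q hQ
  have e : ∀ S : QMat n, S - hat = (S - ρ) - (hat - ρ) := fun S => by abel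
  rw [e T, e Q, frobSq_sub (hT.1.sub hρ) hE, frobSq_sub (hQ.sub hρ) hE] at hmin
  have hw := re_trace_mul_le (hT.1.sub hQ) ht h1 h2
  have hw1 : ((T - Q) * (hat - ρ)).trace.re
      = ((T - ρ) * (hat - ρ)).trace.re - ((Q - ρ) * (hat - ρ)).trace.re := by
    rw [← Complex.sub_re, ← trace_sub, ← sub_mul, sub_sub_sub_cancel_right]
  have hr : ((T - Q).rank : ℝ) ≤ T.rank + Q.rank := by
    exact_mod_cast rank_sub_le T Q
  have hf : √(frobSq (T - Q)) ≤ √(frobSq (T - ρ)) + √(frobSq (Q - ρ)) := by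
    rw [← sub_sub_sub_cancel_right T Q ρ]
    exact Real.sqrt_le_iff.2 ⟨by positivity,
      PauliTomography.frobSq_sub_le (hT.1.sub hρ) (hQ.sub hρ)⟩
  have hw2 : ((T - Q) * (hat - ρ)).trace.re
      ≤ t * √(T.rank + Q.rank) * (√(frobSq (T - ρ)) + √(frobSq (Q - ρ))) :=
    hw.trans (by gcongr)
  rw [← Real.sq_sqrt (frobSq_nonneg (T - ρ)), ← Real.sq_sqrt (frobSq_nonneg (Q - ρ))] at hmin ⊢
  exact oracle_arith hθ hν (by positivity) (by linarith) hw2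

/-- The truncation of `ρ` to its `k` largest eigenvalues. -/
theorem exists_rank_le_frobSq_sub_eq_tailSq (hρ : ρ.IsHermitian) (k : ℕ) :
    ∃ Q : QMat n, Q.IsHermitian ∧ Q.rank ≤ k ∧ frobSq (Q - ρ) = tailSq hρ k := by
  -- This is the bijection by which `eigenvalues` relabels the sorted list `eigenvalues₀`, so
  -- truncation through it keeps the k largest.
  let e : Fin (Fintype.card (Idx n)) ≃ Idx n := Fintype.equivOfCardEq (Fintype.card_fin _)
  let f : Idx n → ℝ := fun i => if k ≤ (e.symm i : ℕ) then 0 else hρ.eigenvalues i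
  refine ⟨spectralMatrix hρ f, spectralMatrix_isHermitian hρ f, ?_, ?_⟩
  · refine (rank_spectralMatrix_le hρ f).trans ?_
    calc _ ≤ (Finset.range k).card :=
          Finset.card_le_card_of_injOn (fun i => (e.symm i : ℕ)) (fun i hi => ?_)
            (fun i _ j _ h => e.symm.injective (Fin.ext h))
      _ = k := Finset.card_range k
    have hi' : f i ≠ 0 := by simpa using hi
    by_contra h
    exact hi' (if_pos (by simpa using h))
  · have h : spectralMatrix hρ f - ρ = spectralMatrix hρ (f - hρ.eigenvalues) := by
      rw [spectralMatrix_sub, spectralMatrix_eigenvalues]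
    rw [h, frobSq_spectralMatrix, tailSq, ← e.sum_comp]
    refine Finset.sum_congr rfl fun j _ => ?_
    have he : hρ.eigenvalues (e j) = hρ.eigenvalues₀ j := by
      simp only [Matrix.IsHermitian.eigenvalues]
      exact congrArg _ (e.symm_apply_apply j)
    simp only [f, Pi.sub_apply, Equiv.symm_apply_apply, he]
    split_ifs <;> simp

open scoped Matrix.Norms.Frobenius in
-- Rank is lower semicontinuous, so the Hermitian matrices of rank at most k form a closed set, and
-- a nearest point exists by finite dimensionality.
theorem exists_frobSq_sub_minimizer (hat : QMat n) (k : ℕ) :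
    ∃ T : QMat n, T.IsHermitian ∧ T.rank ≤ k ∧
      ∀ S : QMat n, S.IsHermitian → S.rank ≤ k → frobSq (T - hat) ≤ frobSq (S - hat) := by
  have hfrob : ∀ S : QMat n, frobSq (S - hat) = dist hat S ^ 2 := fun S => by
    rw [dist_comm, dist_eq_norm, frobSq_eq_sum, Matrix.frobenius_norm_def, ← Real.sqrt_eq_rpow,
      Real.sq_sqrt (by positivity)]
    simp
  let Φ : QMat n →ₗ[ℂ] ((Idx n → ℂ) →L[ℂ] (Idx n → ℂ)) :=
    (LinearMap.toContinuousLinearMap.toLinearMap).comp (Matrix.toLin' (R := ℂ)).toLinearMap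
  have hΦ : Continuous Φ := LinearMap.continuous_of_finiteDimensional Φ
  have hrank : ∀ S : QMat n, ((Φ S : (Idx n → ℂ) →ₗ[ℂ] (Idx n → ℂ))).rank = (S.rank : Cardinal) :=
    fun S => (Module.finrank_eq_rank ℂ _).symm
  have hcl : IsClosed {S : QMat n | S.IsHermitian ∧ S.rank ≤ k} := by
    refine (isClosed_eq continuous_star continuous_id).inter
      (?_ : IsClosed {S : QMat n | S.rank ≤ k})
    have ho := (isOpen_setOfPred_nat_le_rank (𝕜 := ℂ) (E := Idx n → ℂ)
      (F := Idx n → ℂ) (k + 1)).preimage hΦ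
    convert! ho.isClosed_compl using 1
    ext S
    simp only [Set.mem_compl_iff, Set.mem_preimage, Set.mem_ofPred_eq, hrank, Nat.cast_le]
    omega
  have : ProperSpace (QMat n) := FiniteDimensional.proper ℂ _
  obtain ⟨T, hT, hd⟩ := hcl.exists_infDist_eq_dist ⟨0, isHermitian_zero, by simp⟩ hat
  refine ⟨T, hT.1, hT.2, fun S hS hSk => ?_⟩
  rw [hfrob, hfrob, ← hd]
  have hmem : S ∈ {S : QMat n | S.IsHermitian ∧ S.rank ≤ k} := ⟨hS, hSk⟩
  exact pow_le_pow_left₀ Metric.infDist_nonneg (Metric.infDist_le_dist_of_mem hmem) 2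

/-- The penalty takes finitely many values: minimize over k the best fit of rank at most k. Charging
k instead of the true rank only overestimates the criterion, as ν ≥ 0. -/
theorem exists_isRankPenalized (hat : QMat n) {ν : ℝ} (hν : 0 ≤ ν) :
    ∃ T, IsRankPenalized hat ν T := by
  choose T hT hTk hmin using exists_frobSq_sub_minimizer hat
  obtain ⟨k, -, hk⟩ := Finset.exists_min_image (Finset.range (Fintype.card (Idx n) + 1))
    (fun k => frobSq (T k - hat) + ν * k) ⟨0, by simp⟩
  refine ⟨T k, hT k, fun S hS => ?_⟩
  have h1 := hk S.rank (Finset.mem_range.2 (Nat.lt_succ_of_le (Matrix.rank_le_card_width S)))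
  have h2 := hmin S.rank S hS le_rfl
  have h3 : ν * ((T k).rank : ℝ) ≤ ν * k :=
    mul_le_mul_of_nonneg_left (by exact_mod_cast hTk k) hν
  linarith

end RankPenalty

end PauliTomography

/-! ### Assembly of the probabilistic and deterministic bounds. -/

open PauliTomography in
/-- With `ν = nuConst n m θ ε`, a minimizer of the penalized
criterion exists for every data set and, with probability larger than `1 - ε`, every minimizer
satisfies the oracle inequality and its two consequences in terms of the rank of `ρ`. -/
theorem corollary1 (n m : ℕ) (hm : 1 ≤ m)
    (ρ : PauliTomography.QMat n) (hρ : PauliTomography.IsDensity ρ)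
    {Ω : Type*} [MeasurableSpace Ω] (P : Measure Ω) [IsProbabilityMeasure P]
    (R : PauliTomography.Setting n → Fin m → Ω → PauliTomography.Outcome n)
    (hR : PauliTomography.IsSample P ρ R)
    (θ ε : ℝ) (hθ : 0 < θ) (hε0 : 0 < ε) (hε1 : ε < 1) :
    (∀ ω, ∃ T, PauliTomography.IsRankPenalized
      (PauliTomography.rhoHat fun a i => R a i ω) (PauliTomography.nuConst n m θ ε) T) ∧
    1 - ε < P.real {ω | ∀ T, PauliTomography.IsRankPenalized
        (PauliTomography.rhoHat fun a i => R a i ω) (PauliTomography.nuConst n m θ ε) T →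
      PauliTomography.frobSq (T - ρ) ≤
          PauliTomography.oracleBound hρ.1.isHermitian θ (PauliTomography.nuConst n m θ ε) ∧
      PauliTomography.frobSq (T - ρ) ≤
          64 * PauliTomography.cConst θ * (1 + θ) * ρ.rank * (4 / 3) ^ n *
            ((n * Real.log 2 - Real.log ε) / m) ∧
      PauliTomography.traceNorm (T - ρ) ^ 2 ≤
          64 * PauliTomography.cConst θ * (1 + θ) * ρ.rank * (8 / 3) ^ n *
            ((n * Real.log 2 - Real.log ε) / m)} := by
  have hm' : (0 : ℝ) < m := by exact_mod_cast hm
  have hL := logDim_pos n hε0 hε1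
  have hv : 0 < 32 * (4 / 3 : ℝ) ^ n * ((n * Real.log 2 - Real.log ε) / m) := by positivity
  let t : ℝ := √(32 * (4 / 3 : ℝ) ^ n * ((n * Real.log 2 - Real.log ε) / m))
  have ht : 0 < t := Real.sqrt_pos.2 hv
  have htsq : t ^ 2 = 32 * (4 / 3 : ℝ) ^ n * ((n * Real.log 2 - Real.log ε) / m) :=
    Real.sq_sqrt hv.le
  have hν : nuConst n m θ ε = (1 + θ) * t ^ 2 := by rw [htsq, nuConst]; ring
  have hν0 : 0 ≤ nuConst n m θ ε := by rw [hν]; positivity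
  have hc : 0 < cConst θ := by rw [cConst]; positivity
  refine ⟨fun ω => exists_isRankPenalized _ hν0, ?_⟩
  have hbad := measureReal_rhoHat_deviation_lt P R hm hρ hR hε0 hε1 ht htsq
  set B : Set Ω := {ω | ¬ (((t : ℂ) • 1 - (rhoHat (fun a i => R a i ω) - ρ)).PosSemidef ∧
      ((t : ℂ) • 1 + (rhoHat (fun a i => R a i ω) - ρ)).PosSemidef)}
  -- Subadditivity on B ∪ Bᶜ is enough, so no measurability of `B` is needed.
  have hgood : 1 - ε < P.real Bᶜ := by
    have h := measureReal_union_le (μ := P) B Bᶜ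
    rw [Set.union_compl_self, probReal_univ] at h
    linarith
  refine hgood.trans_le (measureReal_mono (fun ω hω => ?_) (measure_ne_top P _))
  obtain ⟨h1, h2⟩ := not_not.1 hω
  intro T hT
  have key := fun Q hQ => hT.frobSq_sub_le hθ ht.le hν hρ.1.1 h1 h2 (Q := Q) hQ
  have hrank : frobSq (T - ρ) ≤ 64 * cConst θ * (1 + θ) * ρ.rank * (4 / 3) ^ n *
      ((n * Real.log 2 - Real.log ε) / m) := by
    -- The competitor Q = ρ has no approximation error and leaves 2c(θ)ν·rank ρ; this is where 64 =
    -- 2·32 arises.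
    have h := key ρ hρ.1.1
    rw [sub_self, nuConst] at h
    have h0 : frobSq (0 : QMat n) = 0 := by simp [frobSq]
    rw [h0] at h
    refine h.trans_eq ?_
    ring
  refine ⟨?_, hrank, ?_⟩
  · refine Finset.le_inf' _ _ fun k _ => ?_
    obtain ⟨Q, hQ, hQk, hQt⟩ := exists_rank_le_frobSq_sub_eq_tailSq hρ.1.1 k
    have h := key Q hQ
    rw [hQt] at h
    refine h.trans ?_
    have : (Q.rank : ℝ) ≤ k := by exact_mod_cast hQk
    gcongr
  · refine (traceNorm_sq_le _).trans ((mul_le_mul_of_nonneg_left hrank (by positivity)).trans_eq ?_)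
    have h : (8 / 3 : ℝ) ^ n = 2 ^ n * (4 / 3) ^ n := by rw [← mul_pow]; norm_num
    rw [h]
    ring
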